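/- Let $\mu$ be the Möbius function. For a real number $x \geq 1$, an integer $q \geq 1$ and a residue class $a \in (\mathbb{Z}/q\mathbb{Z})^{\times}$, let $$S(x;q,a) = \sum_{\substack{1 \leq n \leq x \\ n \equiv a \ (\mathrm{mod}\ q)}} |\mu(n)|, \qquad c_q = \prod_{p \nmid q} \left( 1 - \frac{1}{p^2} \right),$$ where the sum is over integers $n$ and the product is over the primes $p$ not dividing $q$, and define the error term $E(x;q,a)$ by $$S(x;q,a) = c_q \frac{x}{q} + E(x;q,a).$$ Let $\varepsilon > 0$ be fixed. There is a constant $C > 0$, depending only on $\varepsilon$, such that for all real $x \geq 1$ and all integers $q$ with $1 \leq q \leq x$, $$\sum_{a \in (\mathbb{Z}/q\mathbb{Z})^{\times}} |E(x;q,a)| \leq C x^{\varepsilon} \left( x^{1/4} q^{3/4} + x^{1/2} q^{1/4} \right).$$ -/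

import Mathlib

namespace SquarefreeAP

/-- `S(x; q, a)`: the sum of `|μ(n)|` over the positive integers `n ≤ x` with `n ≡ a` modulo `q`. -/
noncomputable def S (x : ℝ) (q : ℕ) (a : ZMod q) : ℝ :=
  ∑ n ∈ (Finset.Icc 1 ⌊x⌋₊).filter (fun n : ℕ => (n : ZMod q) = a),
    |(ArithmeticFunction.moebius n : ℝ)|

/-- The local factor at `p` of the constant `c q`: it is `1 - 1 / p ^ 2` if `p` does not
divide `q`, and `1` otherwise. -/
noncomputable def localFactor (q : ℕ) (p : Nat.Primes) : ℝ :=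
  if (p : ℕ) ∣ q then 1 else 1 - 1 / ((p : ℕ) : ℝ) ^ 2

/-- The infinite product over the primes not dividing `q` converges unconditionally. -/
theorem multipliable_localFactor (q : ℕ) : Multipliable (localFactor q) := by
  have hs : Summable (fun p : Nat.Primes => 1 / ((p : ℕ) : ℝ) ^ 2) :=
    (Real.summable_one_div_nat_pow.mpr one_lt_two).comp_injective Subtype.val_injective
  have h : Summable (fun p : Nat.Primes =>
      if (p : ℕ) ∣ q then (0 : ℝ) else -(1 / ((p : ℕ) : ℝ) ^ 2)) := by
    refine Summable.of_norm_bounded hs (fun p => ?_)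
    split_ifs
    · simp
    · simp
  refine (Real.multipliable_one_add_of_summable h).congr (fun p => ?_)
  unfold localFactor
  split_ifs <;> ring

/-- `c_q`, the product of `1 - 1 / p ^ 2` over all primes `p` not dividing `q`. -/
noncomputable def c (q : ℕ) : ℝ := ∏' p : Nat.Primes, localFactor q p

/-- The error term `E(x; q, a)`, defined by `S(x; q, a) = c_q x / q + E(x; q, a)`. -/
noncomputable def E (x : ℝ) (q : ℕ) (a : ZMod q) : ℝ := S x q a - c q * (x / q)

end SquarefreeAP

namespace SquarefreeAP

/-! Write `|μ(n)|` as the sum of `μ(d)` over `d ^ 2 ∣ n` and cut at `d ≤ T`, where `T = √(x / √q)`.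
Summed over all classes, the terms `d > T` and the tail of the series of `c_q` cost `O(x / T) =
O(x^(1/2) q^(1/4))` (`sum_abs_E_le`).

For `d ≤ T`, Cauchy–Schwarz over the classes and Parseval on `ZMod q` replace the squared `L¹` norm
by the sum over frequencies `h` of the squared Fourier coefficients. For `h ≠ 0` a coefficient is at
most `∑ d, min (x / d ^ 2) (q / ‖h d ^ 2‖)`, with `‖·‖` the distance to `0` modulo `q`. A dyadic
splitting turns its second moment into counts of triples `(h, d₁, d₂)` with `d₁, d₂ ≤ D` and both
`‖h dᵢ ^ 2‖ ≤ H`.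

The heart is the bound `τ(q) (D H^(3/2) + H ^ 2 D ^ 2 / q)`, up to constants, for that count
(`card_allTriples_le`). Dividing out `gcd(d₁, d₂)` leaves coprime pairs `u` with `k₁ u₂ ^ 2 ≡ k₂ u₁
^ 2` modulo `q` and small `k₁, k₂`. Up to `τ(q)` classes, the solutions of such a congruence have
determinants that are zero or large (`dvd_two_mul_det`), so their slopes are well spaced and there
are few of them. -/

/-! ### The divisor bound and elementary sums. -/

theorem add_one_le_mul_rpow {ε : ℝ} (hε : 0 < ε) {p : ℕ} (hp : 2 ≤ p) (v : ℕ) :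
    ((v : ℝ) + 1) ≤ (1 + 1 / (ε * Real.log 2)) * ((p : ℝ) ^ v) ^ ε := by
  have hl : 0 < ε * Real.log 2 := mul_pos hε (Real.log_pos one_lt_two)
  have h2 : 1 + v * (ε * Real.log 2) ≤ ((p : ℝ) ^ v) ^ ε := by
    have h3 : ((2 : ℝ) ^ v) ^ ε = Real.exp (v * (ε * Real.log 2)) := by
      rw [← Real.rpow_natCast, ← Real.rpow_mul (by norm_num), Real.rpow_def_of_pos (by norm_num)]
      congr 1; ring
    have h4 : ((2 : ℝ) ^ v) ^ ε ≤ ((p : ℝ) ^ v) ^ ε := by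
      have : (2 : ℝ) ≤ p := by exact_mod_cast hp
      gcongr
    have := Real.add_one_le_exp (v * (ε * Real.log 2))
    linarith
  have h5 : (1 + 1 / (ε * Real.log 2)) * (1 + v * (ε * Real.log 2)) =
      1 + v * (ε * Real.log 2) + 1 / (ε * Real.log 2) + v := by
    field_simp; ring
  calc ((v : ℝ) + 1) ≤ (1 + 1 / (ε * Real.log 2)) * (1 + v * (ε * Real.log 2)) := by
        rw [h5]
        have : 0 ≤ v * (ε * Real.log 2) := by positivity
        have : 0 ≤ 1 / (ε * Real.log 2) := by positivity
        linarith
    _ ≤ _ := by gcongr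

/-- Primes beyond `2 ^ (1 / ε)` lose no constant, so only boundedly many primes contribute to the
constant in the divisor bound. -/
theorem add_one_le_rpow {ε : ℝ} (hε : 0 < ε) {p : ℕ} (hp : (2 : ℝ) ^ (1 / ε) ≤ p) (v : ℕ) :
    ((v : ℝ) + 1) ≤ ((p : ℝ) ^ v) ^ ε := by
  have h1 : (2 : ℝ) ≤ (p : ℝ) ^ ε := by
    calc (2 : ℝ) = ((2 : ℝ) ^ (1 / ε)) ^ ε := by
          rw [← Real.rpow_mul (by norm_num), one_div_mul_cancel hε.ne', Real.rpow_one]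
      _ ≤ _ := by gcongr
  calc ((v : ℝ) + 1) ≤ 2 ^ v := by exact_mod_cast Nat.lt_two_pow_self
    _ ≤ ((p : ℝ) ^ ε) ^ v := by gcongr
    _ = ((p : ℝ) ^ v) ^ ε := by
      rw [← Real.rpow_natCast, ← Real.rpow_natCast, ← Real.rpow_mul (by positivity),
        ← Real.rpow_mul (by positivity), mul_comm]

/-- The divisor bound. -/
theorem exists_card_divisors_le {ε : ℝ} (hε : 0 < ε) :
    ∃ C : ℝ, 1 ≤ C ∧ ∀ n : ℕ, n ≠ 0 → (n.divisors.card : ℝ) ≤ C * (n : ℝ) ^ ε := by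
  set K : ℝ := 1 + 1 / (ε * Real.log 2) with hK
  have hl : 0 < ε * Real.log 2 := mul_pos hε (Real.log_pos one_lt_two)
  have hK1 : 1 ≤ K := by
    have : 0 ≤ 1 / (ε * Real.log 2) := by positivity
    linarith
  set B : ℕ := ⌈(2 : ℝ) ^ (1 / ε)⌉₊ with hB
  -- A factor `K` is lost at each prime below `B`, hence at most `B` times.
  refine ⟨K ^ B, one_le_pow₀ hK1, fun n hn => ?_⟩
  have hn' : (n : ℝ) ^ ε = ∏ p ∈ n.primeFactors, ((p : ℝ) ^ n.factorization p) ^ ε := by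
    conv_lhs => rw [← Nat.prod_factorization_pow_eq_self hn]
    rw [Finsupp.prod, Nat.support_factorization, Nat.cast_prod,
      ← Real.finsetProd_rpow _ _ (fun _ _ => by positivity)]
    simp
  rw [Nat.card_divisors hn, hn', Nat.cast_prod]
  calc ∏ p ∈ n.primeFactors, ((n.factorization p + 1 : ℕ) : ℝ)
      ≤ ∏ p ∈ n.primeFactors, ((if p < B then K else 1) * ((p : ℝ) ^ n.factorization p) ^ ε) := by
        refine Finset.prod_le_prod (fun _ _ => by positivity) (fun p hp => ?_)
        push_cast
        split_ifs with h
        · exact add_one_le_mul_rpow hε (Nat.prime_of_mem_primeFactors hp).two_le _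
        · rw [one_mul]
          exact add_one_le_rpow hε (Nat.ceil_le.mp (not_lt.mp h)) _
    _ = (∏ p ∈ n.primeFactors, (if p < B then K else 1)) *
          ∏ p ∈ n.primeFactors, ((p : ℝ) ^ n.factorization p) ^ ε := Finset.prod_mul_distrib
    _ ≤ _ := by
        refine mul_le_mul_of_nonneg_right ?_ (Finset.prod_nonneg fun _ _ => by positivity)
        rw [Finset.prod_ite, Finset.prod_const, Finset.prod_const_one, mul_one]
        refine pow_le_pow_right₀ hK1 ?_
        calc _ ≤ (Finset.range B).card := Finset.card_le_card fun p hp => by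
              simpa using (Finset.mem_filter.mp hp).2
          _ = B := Finset.card_range B

/-- Bounds the number of dyadic levels; it is the prime-power estimate at `p = 2`, since `2 ^
Nat.log 2 ⌊x⌋₊ ≤ x`. -/
theorem exists_log_add_one_le {ε : ℝ} (hε : 0 < ε) :
    ∃ C : ℝ, 1 ≤ C ∧ ∀ x : ℝ, 1 ≤ x → ((Nat.log 2 ⌊x⌋₊ + 1 : ℕ) : ℝ) ≤ C * x ^ ε := by
  refine ⟨1 + 1 / (ε * Real.log 2), ?_, fun x hx => ?_⟩
  · have : 0 < ε * Real.log 2 := mul_pos hε (Real.log_pos one_lt_two)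
    have : 0 ≤ 1 / (ε * Real.log 2) := by positivity
    linarith
  · have h := add_one_le_mul_rpow hε le_rfl (Nat.log 2 ⌊x⌋₊)
    have hl : 0 < ε * Real.log 2 := mul_pos hε (Real.log_pos one_lt_two)
    have h1 : ((2 : ℕ) : ℝ) ^ Nat.log 2 ⌊x⌋₊ ≤ x := by
      have : 2 ^ Nat.log 2 ⌊x⌋₊ ≤ ⌊x⌋₊ := Nat.pow_log_le_self 2 (Nat.floor_pos.mpr hx).ne'
      calc ((2 : ℕ) : ℝ) ^ Nat.log 2 ⌊x⌋₊ ≤ (⌊x⌋₊ : ℝ) := by exact_mod_cast this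
        _ ≤ x := Nat.floor_le (by linarith)
    push_cast
    refine h.trans ?_
    gcongr

theorem sum_inv_sq_le (s : Finset ℕ) {T : ℝ} (hT : 0 < T) (hs : ∀ d ∈ s, T < d) :
    ∑ d ∈ s, ((d : ℝ) ^ 2)⁻¹ ≤ 2 / T := by
  obtain ⟨n, hn⟩ := s.bddAbove
  calc ∑ d ∈ s, ((d : ℝ) ^ 2)⁻¹ ≤ ∑ d ∈ Finset.Ioo ⌊T⌋₊ (n + 1), ((d : ℝ) ^ 2)⁻¹ := by
        refine Finset.sum_le_sum_of_subset_of_nonneg (fun d hd => ?_) (fun _ _ _ => by positivity)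
        rw [Finset.mem_Ioo]
        exact ⟨(Nat.floor_lt hT.le).mpr (hs d hd), Nat.lt_succ_of_le (hn hd)⟩
    _ ≤ 2 / (⌊T⌋₊ + 1) := sum_Ioo_inv_sq_le _ _
    _ ≤ 2 / T := by
      have := Nat.lt_floor_add_one T
      gcongr

theorem sum_inv_sq_le_two (s : Finset ℕ) : ∑ d ∈ s, ((d : ℝ) ^ 2)⁻¹ ≤ 2 := by
  obtain ⟨n, hn⟩ := s.bddAbove
  have h0 : ∑ d ∈ s, ((d : ℝ) ^ 2)⁻¹ = ∑ d ∈ s.filter (0 < ·), ((d : ℝ) ^ 2)⁻¹ := by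
    rw [Finset.sum_filter]
    refine Finset.sum_congr rfl fun d _ => ?_
    rcases Nat.eq_zero_or_pos d with rfl | h
    · simp
    · simp [h]
  rw [h0]
  calc _ ≤ ∑ d ∈ Finset.Ioo 0 (n + 1), ((d : ℝ) ^ 2)⁻¹ := by
        refine Finset.sum_le_sum_of_subset_of_nonneg (fun d hd => ?_) (fun _ _ _ => by positivity)
        rw [Finset.mem_filter] at hd
        rw [Finset.mem_Ioo]
        exact ⟨hd.2, Nat.lt_succ_of_le (hn hd.1)⟩
    _ ≤ 2 / ((0 : ℕ) + 1) := sum_Ioo_inv_sq_le _ _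
    _ = 2 := by norm_num

/-! ### Counting pairs by the spacing of their slopes. -/

/-- Distinct reduced fractions `u₁ / u₂` and `v₁ / v₂` differ by the determinant over `u₂ v₂`, so by
at least `Q / U ^ 2`, and all lie in `(0, 1]`. Hence the integer part of slope times `U ^ 2 / Q`
separates them. -/
theorem card_le_of_slope_spacing (P : Finset (ℕ × ℕ)) {U Q : ℝ} (hQ : 0 < Q)
    (hP : ∀ u ∈ P, 0 < u.1 ∧ u.1 ≤ u.2 ∧ (u.2 : ℝ) ≤ U ∧ u.1.Coprime u.2)
    (hc : ∀ u ∈ P, ∀ v ∈ P, (u.1 * v.2 - v.1 * u.2 : ℤ) ≠ 0 →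
      Q ≤ |((u.1 * v.2 - v.1 * u.2 : ℤ) : ℝ)|) :
    (P.card : ℝ) ≤ 1 + U ^ 2 / Q := by
  have hA : 0 ≤ U ^ 2 / Q := by positivity
  have h : P.card ≤ (Finset.range (⌊U ^ 2 / Q⌋₊ + 1)).card := by
    refine Finset.card_le_card_of_injOn
      (fun u => ⌊(u.1 : ℝ) / u.2 * (U ^ 2 / Q)⌋₊) (fun u hu => ?_) (fun u hu v hv huv => ?_)
    · obtain ⟨h1, h2, h3, -⟩ := hP u hu
      simp only [Finset.coe_range, Set.mem_Iio]
      refine Nat.lt_succ_of_le (Nat.floor_le_floor ?_)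
      refine mul_le_of_le_one_left hA (div_le_one_of_le₀ ?_ (by positivity))
      exact_mod_cast h2
    · by_contra hne
      obtain ⟨h1, h2, h3, h4⟩ := hP u hu
      obtain ⟨k1, k2, k3, k4⟩ := hP v hv
      have hcr : (u.1 * v.2 - v.1 * u.2 : ℤ) ≠ 0 := by
        intro h0
        have h0' : u.1 * v.2 = v.1 * u.2 := by
          have := sub_eq_zero.mp h0
          exact_mod_cast this
        apply hne
        have e1 : u.1 ∣ v.1 := h4.dvd_of_dvd_mul_right (h0' ▸ Dvd.intro _ rfl)
        have e2 : v.1 ∣ u.1 := k4.dvd_of_dvd_mul_right (h0'.symm ▸ Dvd.intro _ rfl)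
        have e3 := Nat.dvd_antisymm e1 e2
        refine Prod.ext e3 ?_
        rw [e3] at h0'
        exact (Nat.eq_of_mul_eq_mul_left k1 h0').symm
      have hQ' := hc u hu v hv hcr
      have pu : (0 : ℝ) < u.2 := by exact_mod_cast h1.trans_le h2
      have pv : (0 : ℝ) < v.2 := by exact_mod_cast k1.trans_le k2
      have a1 := Nat.floor_le (a := (u.1 : ℝ) / u.2 * (U ^ 2 / Q)) (by positivity)
      have a2 := Nat.lt_floor_add_one ((u.1 : ℝ) / u.2 * (U ^ 2 / Q))
      have b1 := Nat.floor_le (a := (v.1 : ℝ) / v.2 * (U ^ 2 / Q)) (by positivity)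
      have b2 := Nat.lt_floor_add_one ((v.1 : ℝ) / v.2 * (U ^ 2 / Q))
      simp only at huv
      rw [huv] at a1 a2
      have hlt : |(u.1 : ℝ) / u.2 * (U ^ 2 / Q) - (v.1 : ℝ) / v.2 * (U ^ 2 / Q)| < 1 := by
        rw [abs_lt]; constructor <;> linarith
      have heq : (u.1 : ℝ) / u.2 * (U ^ 2 / Q) - (v.1 : ℝ) / v.2 * (U ^ 2 / Q) =
          ((u.1 * v.2 - v.1 * u.2 : ℤ) : ℝ) / Q * (U ^ 2 / (u.2 * v.2)) := by
        push_cast; field_simp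
      rw [heq, abs_mul, abs_div, abs_of_pos hQ,
        abs_of_nonneg (show (0 : ℝ) ≤ U ^ 2 / (u.2 * v.2) by positivity)] at hlt
      have g1 : 1 ≤ |((u.1 * v.2 - v.1 * u.2 : ℤ) : ℝ)| / Q := (one_le_div hQ).mpr hQ'
      have g2 : 1 ≤ U ^ 2 / ((u.2 : ℝ) * v.2) := by
        rw [one_le_div (by positivity), sq]
        exact mul_le_mul h3 k3 pv.le (pu.le.trans h3)
      nlinarith
  rw [Finset.card_range] at h
  calc (P.card : ℝ) ≤ ((⌊U ^ 2 / Q⌋₊ + 1 : ℕ) : ℝ) := by exact_mod_cast h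
    _ ≤ _ := by
      push_cast
      linarith [Nat.floor_le hA]

/-- Pairwise coprime pairs in a box whose pairwise determinants are zero or at least `Q`. -/
theorem card_le_of_det_spacing (P : Finset (ℕ × ℕ)) {U Q : ℝ} (hQ : 0 < Q)
    (hP : ∀ u ∈ P, 0 < u.1 ∧ 0 < u.2 ∧ (u.1 : ℝ) ≤ U ∧ (u.2 : ℝ) ≤ U ∧ u.1.Coprime u.2)
    (hc : ∀ u ∈ P, ∀ v ∈ P, (u.1 * v.2 - v.1 * u.2 : ℤ) ≠ 0 →
      Q ≤ |((u.1 * v.2 - v.1 * u.2 : ℤ) : ℝ)|) :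
    (P.card : ℝ) ≤ 2 * (1 + U ^ 2 / Q) := by
  have h1 : ((P.filter (fun u => u.1 ≤ u.2)).card : ℝ) ≤ 1 + U ^ 2 / Q := by
    refine card_le_of_slope_spacing _ hQ (fun u hu => ?_) (fun u hu v hv => ?_)
    · rw [Finset.mem_filter] at hu
      obtain ⟨a, b, c, d, e⟩ := hP u hu.1
      exact ⟨a, hu.2, d, e⟩
    · exact hc u (Finset.mem_filter.mp hu).1 v (Finset.mem_filter.mp hv).1
  -- Swapping coordinates brings slopes above `1` below `1` and only changes the sign of
  -- determinants.
  have h2 : (((P.filter (fun u => ¬ u.1 ≤ u.2)).image Prod.swap).card : ℝ) ≤ 1 + U ^ 2 / Q := by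
    refine card_le_of_slope_spacing _ hQ (fun u hu => ?_) (fun u hu v hv h0 => ?_)
    · obtain ⟨w, hw, rfl⟩ := Finset.mem_image.mp hu
      rw [Finset.mem_filter] at hw
      obtain ⟨a, b, c, d, e⟩ := hP w hw.1
      exact ⟨b, (not_le.mp hw.2).le, c, e.symm⟩
    · obtain ⟨w, hw, rfl⟩ := Finset.mem_image.mp hu
      obtain ⟨z, hz, rfl⟩ := Finset.mem_image.mp hv
      have e : ((w.swap.1 : ℤ) * z.swap.2 - z.swap.1 * w.swap.2) =
        z.1 * w.2 - w.1 * z.2 := by simp only [Prod.fst_swap, Prod.snd_swap]; ring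
      rw [e] at h0 ⊢
      exact hc z (Finset.mem_filter.mp hz).1 w (Finset.mem_filter.mp hw).1 h0
  rw [Finset.card_image_of_injective _ Prod.swap_injective] at h2
  have h3 := P.card_filter_add_card_filter_not (fun u => u.1 ≤ u.2)
  have h4 : (P.card : ℝ) = (P.filter (fun u => u.1 ≤ u.2)).card +
    (P.filter (fun u => ¬ u.1 ≤ u.2)).card := by exact_mod_cast h3.symm
  linarith

/-! ### Coprime solutions of `k₁ u₂ ^ 2 ≡ k₂ u₁ ^ 2` modulo `q`. -/

/-- Coprime pairs of positive integers up to `U`, both prime to `q`. -/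
noncomputable def coprimePairs (q : ℕ) (U : ℝ) : Finset (ℕ × ℕ) :=
  (Finset.Icc 1 ⌊U⌋₊ ×ˢ Finset.Icc 1 ⌊U⌋₊).filter
    (fun u => u.1.Coprime u.2 ∧ u.1.Coprime q ∧ u.2.Coprime q)

theorem mem_coprimePairs {q : ℕ} {U : ℝ} {u : ℕ × ℕ} :
    u ∈ coprimePairs q U ↔ (1 ≤ u.1 ∧ u.1 ≤ ⌊U⌋₊) ∧ (1 ≤ u.2 ∧ u.2 ≤ ⌊U⌋₊) ∧
      u.1.Coprime u.2 ∧ u.1.Coprime q ∧ u.2.Coprime q := by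
  simp [coprimePairs, Finset.mem_filter, and_assoc]

/-- Let `s` be the common gcd and `m = s t`. Modulo `s`, both `u` and `w` are proportional to `v`;
modulo `t`, both are proportional to the reflection `(v₁, -v₂)`. So `s` and `t` each divide the
determinant of `u` and `w`, and so does their lcm. Their gcd divides `2 u₁ v₂`, the sum of the two
factors, and `u₁ v₂` is prime to `m`, so the gcd divides `2`. -/
theorem dvd_two_mul_det {m u₁ u₂ w₁ w₂ v₁ v₂ : ℤ} (hu : IsCoprime u₁ m) (hv : IsCoprime v₂ m)
    (h : m ∣ (u₁ * v₂ - v₁ * u₂) * (u₁ * v₂ + v₁ * u₂))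
    (h' : m ∣ (w₁ * v₂ - v₁ * w₂) * (w₁ * v₂ + v₁ * w₂))
    (hs : Int.gcd (u₁ * v₂ - v₁ * u₂) m = Int.gcd (w₁ * v₂ - v₁ * w₂) m) (hm : m ≠ 0) :
    m ∣ 2 * (u₁ * w₂ - w₁ * u₂) := by
  set s : ℤ := ((Int.gcd (u₁ * v₂ - v₁ * u₂) m : ℕ) : ℤ) with hsdef
  have hs0 : s ≠ 0 := by
    rw [hsdef]
    exact_mod_cast (Int.gcd_pos_of_ne_zero_right _ hm).ne'
  obtain ⟨t, ht⟩ : s ∣ m := Int.gcd_dvd_right ..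
  -- Once `s = gcd(x, m)` is cancelled, `t` is prime to `x / s`.
  have key : ∀ x A : ℤ, (Int.gcd x m : ℤ) = s → m ∣ x * A → t ∣ A := by
    intro x A hx hA
    obtain ⟨y, hy⟩ : s ∣ x := hx ▸ Int.gcd_dvd_left ..
    have hc : IsCoprime t y := by
      rw [Int.isCoprime_iff_gcd_eq_one, Int.gcd_comm]
      have : (Int.gcd x m : ℤ) = |s| * Int.gcd y t := by
        rw [hy, ht, Int.gcd_mul_left]; push_cast; rfl
      rw [hx, abs_of_nonneg (by rw [hsdef]; positivity)] at this
      have h1 : s * 1 = s * (Int.gcd y t : ℤ) := by rw [mul_one]; exact this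
      have := mul_left_cancel₀ hs0 h1
      exact_mod_cast this.symm
    refine hc.dvd_of_dvd_mul_left ?_
    rw [ht, hy, mul_assoc] at hA
    exact (mul_dvd_mul_iff_left hs0).mp hA
  have t1 := key _ _ rfl h
  have t2 := key _ _ (by rw [hsdef, hs]) h'
  have s1 : s ∣ u₁ * v₂ - v₁ * u₂ := Int.gcd_dvd_left ..
  have s2 : s ∣ w₁ * v₂ - v₁ * w₂ := by rw [hsdef, hs]; exact Int.gcd_dvd_left ..
  have hsm : s ∣ m := ⟨t, ht⟩
  have htm : t ∣ m := ⟨s, by rw [ht, mul_comm]⟩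
  have cs : s ∣ u₁ * w₂ - w₁ * u₂ := by
    refine (hv.of_isCoprime_of_dvd_right hsm).symm.dvd_of_dvd_mul_left (y := v₂) ?_
    have e : v₂ * (u₁ * w₂ - w₁ * u₂) =
      w₂ * (u₁ * v₂ - v₁ * u₂) - u₂ * (w₁ * v₂ - v₁ * w₂) := by ring
    rw [e]
    exact dvd_sub (Dvd.dvd.mul_left s1 _) (Dvd.dvd.mul_left s2 _)
  have ct : t ∣ u₁ * w₂ - w₁ * u₂ := by
    refine (hv.of_isCoprime_of_dvd_right htm).symm.dvd_of_dvd_mul_left (y := v₂) ?_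
    have e : v₂ * (u₁ * w₂ - w₁ * u₂) =
      w₂ * (u₁ * v₂ + v₁ * u₂) - u₂ * (w₁ * v₂ + v₁ * w₂) := by ring
    rw [e]
    exact dvd_sub (Dvd.dvd.mul_left t1 _) (Dvd.dvd.mul_left t2 _)
  have hr : (Int.gcd s t : ℤ) ∣ 2 := by
    have r1 : (Int.gcd s t : ℤ) ∣ s := Int.gcd_dvd_left ..
    have r2 : (Int.gcd s t : ℤ) ∣ t := Int.gcd_dvd_right ..
    have hco : IsCoprime (Int.gcd s t : ℤ) (u₁ * v₂) :=
      (IsCoprime.mul_left (hu.of_isCoprime_of_dvd_right (r1.trans hsm))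
        (hv.of_isCoprime_of_dvd_right (r1.trans hsm))).symm
    refine hco.dvd_of_dvd_mul_right ?_
    have e : 2 * (u₁ * v₂) = (u₁ * v₂ - v₁ * u₂) + (u₁ * v₂ + v₁ * u₂) := by ring
    rw [e]
    exact dvd_add (r1.trans s1) (r2.trans t1)
  have hl : (Int.lcm s t : ℤ) ∣ u₁ * w₂ - w₁ * u₂ := Int.coe_lcm_dvd cs ct
  have hst : s * t ∣ (Int.gcd s t : ℤ) * Int.lcm s t := by
    have h3 := Int.gcd_mul_lcm s t
    rw [← Int.natCast_mul, h3, Int.dvd_natCast, Int.natAbs_mul]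
  rw [ht]
  exact hst.trans (mul_dvd_mul hr hl)

/-- Fix one solution `v`. Eliminating `k₂` between its congruence and that of `u` shows that `m = q
/ gcd(k₁, q)` divides `(u₁ v₂ - v₁ u₂) (u₁ v₂ + v₁ u₂)`. Sort the solutions by the gcd of the first
factor with `m`: there are at most `τ(m)` classes, and inside each the determinants are zero or at
least `m / 2`. -/
theorem card_coprimePairs_filter_le {q : ℕ} (hq : q ≠ 0) (U : ℝ) (k₁ k₂ : ℤ) :
    (((coprimePairs q U).filter
      (fun u => (q : ℤ) ∣ k₁ * (u.2 : ℤ) ^ 2 - k₂ * (u.1 : ℤ) ^ 2)).card : ℝ) ≤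
      2 * q.divisors.card * (1 + 2 * U ^ 2 * Int.gcd k₁ q / q) := by
  set W := (coprimePairs q U).filter
      (fun u => (q : ℤ) ∣ k₁ * (u.2 : ℤ) ^ 2 - k₂ * (u.1 : ℤ) ^ 2) with hW
  rcases W.eq_empty_or_nonempty with h0 | ⟨v, hv⟩
  · rw [h0]; simp only [Finset.card_empty, Nat.cast_zero]; positivity
  have hδ : 0 < Int.gcd k₁ q := Int.gcd_pos_of_ne_zero_right _ (by exact_mod_cast hq)
  obtain ⟨κ, m, hcop, hκ, hm⟩ := Int.exists_gcd_one hδ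
  have hm0 : 0 < m := by
    have h1 : (0 : ℤ) < q := by exact_mod_cast Nat.pos_of_ne_zero hq
    rw [hm] at h1
    exact pos_of_mul_pos_left h1 (by positivity)
  lift m to ℕ using hm0.le
  have hmN : q = m * Int.gcd k₁ q := by exact_mod_cast hm
  have hm0' : 0 < m := by exact_mod_cast hm0
  have hmq : m ∣ q := ⟨_, hmN⟩
  have memW : ∀ u ∈ W, ((1 ≤ u.1 ∧ u.1 ≤ ⌊U⌋₊) ∧ (1 ≤ u.2 ∧ u.2 ≤ ⌊U⌋₊) ∧
      u.1.Coprime u.2 ∧ u.1.Coprime q ∧ u.2.Coprime q) ∧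
      (q : ℤ) ∣ k₁ * (u.2 : ℤ) ^ 2 - k₂ * (u.1 : ℤ) ^ 2 := fun u hu => by
    rw [hW, Finset.mem_filter, mem_coprimePairs] at hu; exact hu
  have hdvd : ∀ u ∈ W, (m : ℤ) ∣ (u.1 * v.2 - v.1 * u.2) * (u.1 * v.2 + v.1 * u.2) := by
    intro u hu
    have h1 : (q : ℤ) ∣ k₁ * ((u.1 * v.2 - v.1 * u.2) * (u.1 * v.2 + v.1 * u.2)) := by
      have e : k₁ * (((u.1 : ℤ) * v.2 - v.1 * u.2) * (u.1 * v.2 + v.1 * u.2)) =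
        (k₁ * (v.2 : ℤ) ^ 2 - k₂ * (v.1 : ℤ) ^ 2) * (u.1 : ℤ) ^ 2 -
        (k₁ * (u.2 : ℤ) ^ 2 - k₂ * (u.1 : ℤ) ^ 2) * (v.1 : ℤ) ^ 2 := by ring
      rw [e]
      exact dvd_sub (Dvd.dvd.mul_right (memW v hv).2 _) (Dvd.dvd.mul_right (memW u hu).2 _)
    have h2 : (m : ℤ) * Int.gcd k₁ q ∣
        κ * ((u.1 * v.2 - v.1 * u.2) * (u.1 * v.2 + v.1 * u.2)) * Int.gcd k₁ q := by
      rw [← hm]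
      convert h1 using 1
      conv_rhs => rw [hκ]
      ring
    have h3 := (mul_dvd_mul_iff_right (by exact_mod_cast hδ.ne')).mp h2
    refine IsCoprime.dvd_of_dvd_mul_left ?_ h3
    rw [Int.isCoprime_iff_gcd_eq_one, Int.gcd_comm]
    exact hcop
  have hmaps : ∀ u ∈ W, Int.gcd ((u.1 : ℤ) * v.2 - v.1 * u.2) m ∈ m.divisors := fun u _ => by
    rw [Nat.mem_divisors]
    refine ⟨?_, hm0'.ne'⟩
    have := Int.gcd_dvd_right ((u.1 : ℤ) * v.2 - v.1 * u.2) m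
    exact_mod_cast this
  have hfib : ∀ s ∈ m.divisors,
      ((W.filter (fun u => Int.gcd ((u.1 : ℤ) * v.2 - v.1 * u.2) m = s)).card : ℝ) ≤
        2 * (1 + U ^ 2 / ((m : ℝ) / 2)) := by
    intro s _
    refine card_le_of_det_spacing _ (by positivity) (fun u hu => ?_) (fun u hu w hw hne => ?_)
    · obtain ⟨⟨⟨a1, a2⟩, ⟨b1, b2⟩, c, -⟩, -⟩ := memW u (Finset.mem_filter.mp hu).1
      exact ⟨a1, b1, (Nat.le_floor_iff' (by omega)).mp a2,
        (Nat.le_floor_iff' (by omega)).mp b2, c⟩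
    · obtain ⟨hu1, hu2⟩ := Finset.mem_filter.mp hu
      obtain ⟨hw1, hw2⟩ := Finset.mem_filter.mp hw
      have hcu : IsCoprime (u.1 : ℤ) (m : ℤ) :=
        Nat.isCoprime_iff_coprime.mpr ((memW u hu1).1.2.2.2.1.coprime_dvd_right hmq)
      have hcv : IsCoprime (v.2 : ℤ) (m : ℤ) :=
        Nat.isCoprime_iff_coprime.mpr ((memW v hv).1.2.2.2.2.coprime_dvd_right hmq)
      have hd := dvd_two_mul_det hcu hcv (hdvd u hu1) (hdvd w hw1)
        (hu2.trans hw2.symm) (by exact_mod_cast hm0'.ne')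
      have hle := Int.le_of_dvd (abs_pos.mpr (mul_ne_zero two_ne_zero hne)) ((dvd_abs _ _).mpr hd)
      rw [abs_mul, abs_two] at hle
      have hle' : (m : ℝ) ≤ 2 * |((u.1 * w.2 - w.1 * u.2 : ℤ) : ℝ)| := by
        rw [← Int.cast_abs]
        exact_mod_cast hle
      linarith
  have hcard : (W.card : ℝ) ≤ m.divisors.card * (2 * (1 + U ^ 2 / ((m : ℝ) / 2))) := by
    rw [Finset.card_eq_sum_card_fiberwise hmaps, Nat.cast_sum]
    exact (Finset.sum_le_sum hfib).trans_eq (by rw [Finset.sum_const, nsmul_eq_mul])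
  have hq' : (Int.gcd k₁ q : ℝ) / q = 1 / m := by
    have : (q : ℝ) = m * Int.gcd k₁ q := by exact_mod_cast hmN
    have h1 : (Int.gcd k₁ q : ℝ) ≠ 0 := by exact_mod_cast hδ.ne'
    have h2 : (m : ℝ) ≠ 0 := by exact_mod_cast hm0'.ne'
    rw [div_eq_div_iff (by rw [this]; positivity) h2, this]; ring
  have hτ : (m.divisors.card : ℝ) ≤ q.divisors.card := by
    exact_mod_cast Finset.card_le_card (Nat.divisors_subset_of_dvd hq hmq)
  calc (W.card : ℝ) ≤ m.divisors.card * (2 * (1 + U ^ 2 / ((m : ℝ) / 2))) := hcard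
    _ ≤ q.divisors.card * (2 * (1 + U ^ 2 / ((m : ℝ) / 2))) := by gcongr
    _ = _ := by rw [mul_div_assoc, hq']; ring

/-! ### Triples with a coprime pair: two bounds. -/

/-- The nonzero multiples of `δ` in `[-H, H]`. -/
noncomputable def nonzeroMultiples (H : ℝ) (δ : ℕ) : Finset ℤ :=
  ((Finset.Icc (-(⌊H⌋₊ : ℤ)) ⌊H⌋₊).erase 0).filter (fun k => (δ : ℤ) ∣ k)

theorem mem_nonzeroMultiples {H : ℝ} (hH : 0 ≤ H) {δ : ℕ} {k : ℤ} :
    k ∈ nonzeroMultiples H δ ↔ k ≠ 0 ∧ (k.natAbs : ℝ) ≤ H ∧ (δ : ℤ) ∣ k := by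
  rw [nonzeroMultiples, Finset.mem_filter, Finset.mem_erase, Finset.mem_Icc, ← Nat.le_floor_iff hH]
  constructor
  · rintro ⟨⟨h1, h2, h3⟩, h4⟩; exact ⟨h1, by omega, h4⟩
  · rintro ⟨h1, h2, h3⟩; exact ⟨⟨h1, by omega, by omega⟩, h3⟩

theorem card_nonzeroMultiples_le {H : ℝ} (hH : 0 ≤ H) {δ : ℕ} (hδ : 0 < δ) :
    ((nonzeroMultiples H δ).card : ℝ) ≤ 2 * (H / δ) := by
  have h : (nonzeroMultiples H δ).card ≤
      ((Finset.Icc (-(⌊H / δ⌋₊ : ℤ)) ⌊H / δ⌋₊).erase 0).card := by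
    refine Finset.card_le_card_of_injOn (fun k => k / δ) (fun k hk => ?_) (fun k hk l hl hkl => ?_)
    · obtain ⟨h1, h2, j, rfl⟩ := (mem_nonzeroMultiples hH).mp hk
      have hd : (δ : ℤ) ≠ 0 := by exact_mod_cast hδ.ne'
      beta_reduce
      rw [Int.mul_ediv_cancel_left _ hd]
      have h3 : j.natAbs ≤ ⌊H / δ⌋₊ := by
        rw [Nat.le_floor_iff (by positivity), le_div_iff₀ (by positivity)]
        rw [Int.natAbs_mul, Int.natAbs_natCast] at h2
        push_cast at h2
        linarith
      have h4 : j ≠ 0 := right_ne_zero_of_mul h1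
      simp only [Finset.coe_erase, Finset.coe_Icc, Set.mem_sdiff, Set.mem_Icc,
        Set.mem_singleton_iff]
      omega
    · obtain ⟨-, -, h1⟩ := (mem_nonzeroMultiples hH).mp hk
      obtain ⟨-, -, h2⟩ := (mem_nonzeroMultiples hH).mp hl
      exact (Int.ediv_left_inj h1 h2).mp hkl
  rw [Finset.card_erase_of_mem (by simp), Int.card_Icc] at h
  have h' : (nonzeroMultiples H δ).card ≤ 2 * ⌊H / δ⌋₊ := by omega
  calc ((nonzeroMultiples H δ).card : ℝ) ≤ ((2 * ⌊H / δ⌋₊ : ℕ) : ℝ) := by exact_mod_cast h'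
    _ ≤ _ := by push_cast; linarith [Nat.floor_le (show 0 ≤ H / δ by positivity)]

/-- The distance of a residue class modulo `q` to the class `0`. -/
def zdist {q : ℕ} (k : ZMod q) : ℕ := k.valMinAbs.natAbs

/-- Nonzero frequencies `g` with coprime pairs `u` such that `g * u.1 ^ 2` and `g * u.2 ^ 2` are
both at distance at most `H` from `0`. -/
noncomputable def coprimeTriples (q : ℕ) [NeZero q] (H U : ℝ) : Finset (ZMod q × (ℕ × ℕ)) :=
  (Finset.univ ×ˢ coprimePairs q U).filter (fun t => t.1 ≠ 0 ∧
    (zdist (t.1 * (t.2.1 : ZMod q) ^ 2) : ℝ) ≤ H ∧ (zdist (t.1 * (t.2.2 : ZMod q) ^ 2) : ℝ) ≤ H)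

theorem isUnit_natCast_sq {q d : ℕ} (h : d.Coprime q) : IsUnit ((d : ZMod q) ^ 2) :=
  ((ZMod.isUnit_iff_coprime d q).mpr h).pow 2

/-- The trivial bound, good for small `U`: since `u₁` is a unit, `u` and the small residue `g u₁ ^
2` determine `g`. The condition at `u₂` is dropped. -/
theorem card_coprimeTriples_le_mul_sq (q : ℕ) [NeZero q] {H U : ℝ} (hH : 0 ≤ H) (hU : 0 ≤ U) :
    ((coprimeTriples q H U).card : ℝ) ≤ 2 * H * U ^ 2 := by
  have hfib : ∀ u ∈ coprimePairs q U,
      ((coprimeTriples q H U).filter (fun t => t.2 = u)).card ≤ (nonzeroMultiples H 1).card := by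
    intro u hu
    have hcop := (mem_coprimePairs.mp hu).2.2.2.1
    refine Finset.card_le_card_of_injOn (fun t => (t.1 * (u.1 : ZMod q) ^ 2).valMinAbs)
      (fun t ht => ?_) (fun t ht s hs hts => ?_)
    · simp only [Finset.mem_coe, Finset.mem_filter, coprimeTriples] at ht
      obtain ⟨⟨-, h1, h2, h3⟩, rfl⟩ := ht
      rw [Finset.mem_coe, mem_nonzeroMultiples hH]
      refine ⟨?_, h2, one_dvd _⟩
      rw [Ne, ZMod.valMinAbs_eq_zero, (isUnit_natCast_sq hcop).mul_left_eq_zero]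
      exact h1
    · simp only [Finset.mem_coe, Finset.mem_filter] at ht hs
      have := ZMod.injective_valMinAbs hts
      exact Prod.ext ((isUnit_natCast_sq hcop).mul_right_cancel this) (ht.2.trans hs.2.symm)
  have hcard : (coprimeTriples q H U).card ≤
      (coprimePairs q U).card * (nonzeroMultiples H 1).card := by
    rw [Finset.card_eq_sum_card_fiberwise (f := Prod.snd) (t := coprimePairs q U)]
    · exact (Finset.sum_le_sum hfib).trans_eq (by rw [Finset.sum_const, smul_eq_mul])
    · intro t ht
      simp only [Finset.mem_coe, Finset.mem_filter, coprimeTriples, Finset.mem_product] at ht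
      exact ht.1.2
  have h1 : ((coprimePairs q U).card : ℝ) ≤ U ^ 2 := by
    have : (coprimePairs q U).card ≤ ⌊U⌋₊ * ⌊U⌋₊ := by
      refine (Finset.card_filter_le _ _).trans_eq ?_
      rw [Finset.card_product, Nat.card_Icc]; simp
    calc ((coprimePairs q U).card : ℝ) ≤ (⌊U⌋₊ : ℝ) * ⌊U⌋₊ := by exact_mod_cast this
      _ ≤ U ^ 2 := by
        have := Nat.floor_le hU
        rw [sq]; gcongr
  have h2 := card_nonzeroMultiples_le hH one_pos
  calc ((coprimeTriples q H U).card : ℝ)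
      ≤ (coprimePairs q U).card * (nonzeroMultiples H 1).card := by exact_mod_cast hcard
    _ ≤ U ^ 2 * (2 * (H / (1 : ℕ))) := by gcongr
    _ = _ := by push_cast; ring

/-- Sort by the representatives `k₁, k₂` of `g u₁ ^ 2` and `g u₂ ^ 2`, which satisfy `k₁ u₂ ^ 2 ≡ k₂
u₁ ^ 2`. The gcd `δ` of `k₁` and `q` must divide `k₂`, leaving at most `2 H / δ` values of `k₂`;
this saving compensates the factor `δ` in `card_coprimePairs_filter_le`. -/
theorem card_coprimeTriples_le (q : ℕ) [NeZero q] {H U : ℝ} (hH : 0 ≤ H) :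
    ((coprimeTriples q H U).card : ℝ) ≤ 8 * q.divisors.card * (H ^ 2 * (1 + 2 * U ^ 2 / q)) := by
  have hq : q ≠ 0 := NeZero.ne q
  set K : Finset ((_ : ℤ) × ℤ) :=
    (nonzeroMultiples H 1).sigma (fun k => nonzeroMultiples H (Int.gcd k q)) with hK
  set f : ZMod q × (ℕ × ℕ) → (_ : ℤ) × ℤ := fun t =>
    ⟨(t.1 * (t.2.1 : ZMod q) ^ 2).valMinAbs, (t.1 * (t.2.2 : ZMod q) ^ 2).valMinAbs⟩ with hf
  have hmem : ∀ t ∈ coprimeTriples q H U, t.2 ∈ coprimePairs q U ∧ t.1 ≠ 0 ∧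
    (zdist (t.1 * (t.2.1 : ZMod q) ^ 2) : ℝ) ≤ H ∧
    (zdist (t.1 * (t.2.2 : ZMod q) ^ 2) : ℝ) ≤ H := by
    intro t ht
    simp only [Finset.mem_filter, coprimeTriples, Finset.mem_product] at ht
    exact ⟨ht.1.2, ht.2⟩
  have hcong : ∀ t : ZMod q × (ℕ × ℕ),
      (q : ℤ) ∣ (f t).1 * (t.2.2 : ℤ) ^ 2 - (f t).2 * (t.2.1 : ℤ) ^ 2 := by
    intro t
    rw [← ZMod.intCast_zmod_eq_zero_iff_dvd]
    push_cast
    rw [hf]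
    simp only [ZMod.coe_valMinAbs]
    ring
  have hmaps : ∀ t ∈ coprimeTriples q H U, f t ∈ K := by
    intro t ht
    obtain ⟨h1, h2, h3, h4⟩ := hmem t ht
    obtain ⟨-, -, -, c1, c2⟩ := mem_coprimePairs.mp h1
    rw [hK, Finset.mem_sigma, mem_nonzeroMultiples hH, mem_nonzeroMultiples hH]
    refine ⟨⟨?_, h3, one_dvd _⟩, ?_, h4, ?_⟩
    · rw [hf, Ne, ZMod.valMinAbs_eq_zero, (isUnit_natCast_sq c1).mul_left_eq_zero]
      exact h2
    · rw [hf, Ne, ZMod.valMinAbs_eq_zero, (isUnit_natCast_sq c2).mul_left_eq_zero]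
      exact h2
    · have d1 : (Int.gcd (f t).1 q : ℤ) ∣ (f t).1 := Int.gcd_dvd_left ..
      have d2 : (Int.gcd (f t).1 q : ℤ) ∣ q := Int.gcd_dvd_right ..
      have d3 : (Int.gcd (f t).1 q : ℤ) ∣ (f t).2 * (t.2.1 : ℤ) ^ 2 := by
        have := dvd_sub (d1.mul_right ((t.2.2 : ℤ) ^ 2)) (d2.trans (hcong t))
        rwa [sub_sub_cancel] at this
      refine IsCoprime.dvd_of_dvd_mul_right ?_ d3
      exact ((Nat.isCoprime_iff_coprime.mpr c1).of_isCoprime_of_dvd_right d2).symm.pow_right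
  have hfib : ∀ k ∈ K, ((coprimeTriples q H U).filter (fun t => f t = k)).card ≤
      ((coprimePairs q U).filter
        (fun u => (q : ℤ) ∣ k.1 * (u.2 : ℤ) ^ 2 - k.2 * (u.1 : ℤ) ^ 2)).card := by
    intro k _
    refine Finset.card_le_card_of_injOn Prod.snd (fun t ht => ?_) (fun t ht s hs hts => ?_)
    · obtain ⟨h1, rfl⟩ := Finset.mem_filter.mp (Finset.mem_coe.mp ht)
      exact Finset.mem_coe.mpr (Finset.mem_filter.mpr ⟨(hmem t h1).1, hcong t⟩)
    · obtain ⟨h1, h2⟩ := Finset.mem_filter.mp (Finset.mem_coe.mp ht)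
      obtain ⟨h3, h4⟩ := Finset.mem_filter.mp (Finset.mem_coe.mp hs)
      obtain ⟨-, -, -, c1, -⟩ := mem_coprimePairs.mp (hmem t h1).1
      have e := congrArg Sigma.fst (h2.trans h4.symm)
      have e' := ZMod.injective_valMinAbs e
      rw [← hts] at e'
      exact Prod.ext ((isUnit_natCast_sq c1).mul_right_cancel e') hts
  have hcard : ((coprimeTriples q H U).card : ℝ) ≤
      ∑ k ∈ K, 2 * (q.divisors.card : ℝ) * (1 + 2 * U ^ 2 * Int.gcd k.1 q / q) := by
    rw [Finset.card_eq_sum_card_fiberwise hmaps, Nat.cast_sum]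
    refine Finset.sum_le_sum fun k hk => ?_
    calc _ ≤ _ := by exact_mod_cast hfib k hk
      _ ≤ _ := card_coprimePairs_filter_le hq U k.1 k.2
  refine hcard.trans ?_
  rw [hK, Finset.sum_sigma]
  have hinner : ∀ k ∈ nonzeroMultiples H 1,
      ∑ _l ∈ nonzeroMultiples H (Int.gcd k q),
        2 * (q.divisors.card : ℝ) * (1 + 2 * U ^ 2 * Int.gcd k q / q) ≤
      4 * q.divisors.card * (H * (1 + 2 * U ^ 2 / q)) := by
    intro k _
    have hδ : 0 < Int.gcd k q := Int.gcd_pos_of_ne_zero_right _ (by exact_mod_cast hq)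
    have hδ1 : (1 : ℝ) ≤ Int.gcd k q := by exact_mod_cast hδ
    rw [Finset.sum_const, nsmul_eq_mul]
    calc _ ≤ 2 * (H / Int.gcd k q) *
          (2 * (q.divisors.card : ℝ) * (1 + 2 * U ^ 2 * Int.gcd k q / q)) := by
          have := card_nonzeroMultiples_le hH hδ
          gcongr
      _ = 4 * q.divisors.card * (H * (1 / Int.gcd k q + 2 * U ^ 2 / q)) := by
          field_simp; ring
      _ ≤ _ := by
          have : 1 / (Int.gcd k q : ℝ) ≤ 1 := by rw [div_le_one (by positivity)]; exact hδ1
          gcongr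
  refine (Finset.sum_le_sum hinner).trans ?_
  rw [Finset.sum_const, nsmul_eq_mul]
  have h2 := card_nonzeroMultiples_le hH one_pos
  calc _ ≤ (2 * (H / (1 : ℕ))) * (4 * q.divisors.card * (H * (1 + 2 * U ^ 2 / q))) := by gcongr
    _ = _ := by push_cast; ring

/-! ### Triples with an arbitrary pair. -/

/-- Nonzero frequencies `h` with pairs `d` of integers up to `D` prime to `q` such that
`h * d.1 ^ 2` and `h * d.2 ^ 2` are both at distance at most `H` from `0`. -/
noncomputable def allTriples (q : ℕ) [NeZero q] (H D : ℝ) : Finset (ZMod q × (ℕ × ℕ)) :=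
  (Finset.univ ×ˢ ((Finset.Icc 1 ⌊D⌋₊).filter (Nat.Coprime · q) ×ˢ
    (Finset.Icc 1 ⌊D⌋₊).filter (Nat.Coprime · q))).filter (fun t => t.1 ≠ 0 ∧
    (zdist (t.1 * (t.2.1 : ZMod q) ^ 2) : ℝ) ≤ H ∧ (zdist (t.1 * (t.2.2 : ZMod q) ^ 2) : ℝ) ≤ H)

theorem mem_allTriples {q : ℕ} [NeZero q] {H D : ℝ} {t : ZMod q × (ℕ × ℕ)} :
    t ∈ allTriples q H D ↔ (((1 ≤ t.2.1 ∧ t.2.1 ≤ ⌊D⌋₊) ∧ t.2.1.Coprime q) ∧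
      ((1 ≤ t.2.2 ∧ t.2.2 ≤ ⌊D⌋₊) ∧ t.2.2.Coprime q)) ∧ t.1 ≠ 0 ∧
    (zdist (t.1 * (t.2.1 : ZMod q) ^ 2) : ℝ) ≤ H ∧
    (zdist (t.1 * (t.2.2 : ZMod q) ^ 2) : ℝ) ≤ H := by
  simp [allTriples]

/-- With `e = gcd(d₁, d₂)`, one has `h dᵢ ^ 2 = (h e ^ 2) (dᵢ / e) ^ 2`, and `h ↦ h e ^ 2` is
injective because `e` is prime to `q`. -/
theorem card_allTriples_le_sum (q : ℕ) [NeZero q] (H D : ℝ) :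
    (allTriples q H D).card ≤ ∑ e ∈ Finset.Icc 1 ⌊D⌋₊, (coprimeTriples q H (D / e)).card := by
  have hmaps : ∀ t ∈ allTriples q H D, Nat.gcd t.2.1 t.2.2 ∈ Finset.Icc 1 ⌊D⌋₊ := by
    intro t ht
    obtain ⟨⟨⟨⟨a, b⟩, -⟩, -⟩, -⟩ := mem_allTriples.mp ht
    rw [Finset.mem_Icc]
    exact ⟨Nat.gcd_pos_of_pos_left _ a, (Nat.gcd_le_left _ a).trans b⟩
  rw [Finset.card_eq_sum_card_fiberwise hmaps]
  refine Finset.sum_le_sum fun e he => ?_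
  have he1 : 0 < e := (Finset.mem_Icc.mp he).1
  refine Finset.card_le_card_of_injOn
    (fun t => (t.1 * (e : ZMod q) ^ 2, (t.2.1 / e, t.2.2 / e)))
    (fun t ht => ?_) (fun t ht s hs hts => ?_)
  · obtain ⟨h1, h2⟩ := Finset.mem_filter.mp (Finset.mem_coe.mp ht)
    obtain ⟨⟨⟨⟨a1, a2⟩, a3⟩, ⟨b1, b2⟩, b3⟩, c, d1, d2⟩ := mem_allTriples.mp h1
    have ea : e ∣ t.2.1 := h2 ▸ Nat.gcd_dvd_left _ _
    have eb : e ∣ t.2.2 := h2 ▸ Nat.gcd_dvd_right _ _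
    have ecop : e.Coprime q := a3.coprime_dvd_left ea
    have hcast : ∀ d : ℕ, e ∣ d → t.1 * (e : ZMod q) ^ 2 * ((d / e : ℕ) : ZMod q) ^ 2 =
        t.1 * (d : ZMod q) ^ 2 := by
      rintro d ⟨j, rfl⟩
      rw [Nat.mul_div_cancel_left _ he1]; push_cast; ring
    have hle : ∀ d : ℕ, d ≤ ⌊D⌋₊ → d / e ≤ ⌊D / e⌋₊ := by
      intro d hd
      rw [Nat.floor_div_natCast]
      exact Nat.div_le_div_right hd
    simp only [Finset.mem_coe, coprimeTriples, Finset.mem_filter, Finset.mem_product,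
      Finset.mem_univ, true_and, mem_coprimePairs]
    refine ⟨⟨⟨?_, hle _ a2⟩, ⟨?_, hle _ b2⟩, ?_, ?_, ?_⟩, ?_, ?_, ?_⟩
    · exact Nat.div_pos (Nat.le_of_dvd a1 ea) he1
    · exact Nat.div_pos (Nat.le_of_dvd b1 eb) he1
    · rw [← h2]
      exact Nat.coprime_div_gcd_div_gcd (h2 ▸ he1)
    · exact a3.coprime_dvd_left (Nat.div_dvd_of_dvd ea)
    · exact b3.coprime_dvd_left (Nat.div_dvd_of_dvd eb)
    · rw [Ne, (isUnit_natCast_sq ecop).mul_left_eq_zero]; exact c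
    · rw [hcast _ ea]; exact d1
    · rw [hcast _ eb]; exact d2
  · obtain ⟨h1, h2⟩ := Finset.mem_filter.mp (Finset.mem_coe.mp ht)
    obtain ⟨h3, h4⟩ := Finset.mem_filter.mp (Finset.mem_coe.mp hs)
    obtain ⟨⟨⟨-, a3⟩, -⟩, -⟩ := mem_allTriples.mp h1
    have ea : e ∣ t.2.1 := h2 ▸ Nat.gcd_dvd_left _ _
    have eb : e ∣ t.2.2 := h2 ▸ Nat.gcd_dvd_right _ _
    have fa : e ∣ s.2.1 := h4 ▸ Nat.gcd_dvd_left _ _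
    have fb : e ∣ s.2.2 := h4 ▸ Nat.gcd_dvd_right _ _
    have ecop : e.Coprime q := a3.coprime_dvd_left ea
    simp only [Prod.mk.injEq] at hts
    obtain ⟨g1, g2, g3⟩ := hts
    exact Prod.ext ((isUnit_natCast_sq ecop).mul_right_cancel g1)
      (Prod.ext ((Nat.div_left_inj ea fa).mp g2) ((Nat.div_left_inj eb fb).mp g3))

theorem card_allTriples_le (q : ℕ) [NeZero q] {H D : ℝ} (hH : 0 < H) (hD : 0 < D) :
    ((allTriples q H D).card : ℝ) ≤
      q.divisors.card * (12 * (D * (H * √H)) + 32 * (H ^ 2 * D ^ 2 / q)) := by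
  have hq : q ≠ 0 := NeZero.ne q
  have hq' : (0 : ℝ) < q := by exact_mod_cast Nat.pos_of_ne_zero hq
  have hτ : (1 : ℝ) ≤ q.divisors.card := by
    exact_mod_cast Finset.card_pos.mpr (Nat.nonempty_divisors.mpr hq)
  set s := √H with hs
  have hs0 : 0 < s := Real.sqrt_pos.mpr hH
  have hss : s ^ 2 = H := Real.sq_sqrt hH.le
  -- Below this cutoff in `e` the bound `card_coprimeTriples_le` is used, above it the trivial one;
  -- it equates `H ^ 2 T` with `H D ^ 2 / T`, both being `D H^(3/2)`.
  set T := D / s with hT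
  have hT0 : 0 < T := by positivity
  have hsum : ((allTriples q H D).card : ℝ) ≤
      ∑ e ∈ Finset.Icc 1 ⌊D⌋₊, ((coprimeTriples q H (D / e)).card : ℝ) := by
    exact_mod_cast card_allTriples_le_sum q H D
  have hsmall : ∑ e ∈ (Finset.Icc 1 ⌊D⌋₊).filter (fun e : ℕ => (e : ℝ) ≤ T),
      ((coprimeTriples q H (D / e)).card : ℝ) ≤
      8 * q.divisors.card * (H ^ 2 * (T + 4 * D ^ 2 / q)) := by
    calc _ ≤ ∑ e ∈ (Finset.Icc 1 ⌊D⌋₊).filter (fun e : ℕ => (e : ℝ) ≤ T),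
          8 * q.divisors.card * (H ^ 2 * (1 + 2 * (D / e) ^ 2 / q)) :=
          Finset.sum_le_sum fun e _ => card_coprimeTriples_le q hH.le
      _ = 8 * q.divisors.card * (H ^ 2 *
          (((Finset.Icc 1 ⌊D⌋₊).filter (fun e : ℕ => (e : ℝ) ≤ T)).card + 2 * D ^ 2 / q *
          ∑ e ∈ (Finset.Icc 1 ⌊D⌋₊).filter (fun e : ℕ => (e : ℝ) ≤ T), ((e : ℝ) ^ 2)⁻¹)) := by
          rw [← Finset.mul_sum, ← Finset.mul_sum, Finset.sum_add_distrib, Finset.mul_sum,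
            Finset.sum_const, nsmul_one]
          congr 3
          refine Finset.sum_congr rfl fun e _ => ?_
          rw [div_pow]; ring
      _ ≤ 8 * q.divisors.card * (H ^ 2 * (T + 2 * D ^ 2 / q * 2)) := by
          have h1 := sum_inv_sq_le_two ((Finset.Icc 1 ⌊D⌋₊).filter (fun e : ℕ => (e : ℝ) ≤ T))
          have h2 : (((Finset.Icc 1 ⌊D⌋₊).filter (fun e : ℕ => (e : ℝ) ≤ T)).card : ℝ) ≤ T := by
            have h3 : ((Finset.Icc 1 ⌊D⌋₊).filter (fun e : ℕ => (e : ℝ) ≤ T)).card ≤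
                (Finset.Icc 1 ⌊T⌋₊).card := by
              refine Finset.card_le_card fun e he => ?_
              obtain ⟨he1, he2⟩ := Finset.mem_filter.mp he
              exact Finset.mem_Icc.mpr ⟨(Finset.mem_Icc.mp he1).1, Nat.le_floor he2⟩
            rw [Nat.card_Icc, Nat.add_sub_cancel] at h3
            calc _ ≤ (⌊T⌋₊ : ℝ) := by exact_mod_cast h3
              _ ≤ T := Nat.floor_le hT0.le
          gcongr
      _ = _ := by ring
  have hlarge : ∑ e ∈ (Finset.Icc 1 ⌊D⌋₊).filter (fun e : ℕ => ¬ (e : ℝ) ≤ T),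
      ((coprimeTriples q H (D / e)).card : ℝ) ≤ 4 * H * D ^ 2 / T := by
    calc _ ≤ ∑ e ∈ (Finset.Icc 1 ⌊D⌋₊).filter (fun e : ℕ => ¬ (e : ℝ) ≤ T),
          2 * H * (D / e) ^ 2 :=
          Finset.sum_le_sum fun e _ => card_coprimeTriples_le_mul_sq q hH.le (by positivity)
      _ = 2 * H * D ^ 2 *
          ∑ e ∈ (Finset.Icc 1 ⌊D⌋₊).filter (fun e : ℕ => ¬ (e : ℝ) ≤ T), ((e : ℝ) ^ 2)⁻¹ := by
          rw [Finset.mul_sum]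
          refine Finset.sum_congr rfl fun e _ => ?_
          rw [div_pow]; ring
      _ ≤ 2 * H * D ^ 2 * (2 / T) := by
          have := sum_inv_sq_le ((Finset.Icc 1 ⌊D⌋₊).filter (fun e : ℕ => ¬ (e : ℝ) ≤ T)) hT0
            (fun e he => not_le.mp (Finset.mem_filter.mp he).2)
          gcongr
      _ = _ := by ring
  rw [← Finset.sum_filter_add_sum_filter_not _ (fun e : ℕ => (e : ℝ) ≤ T)] at hsum
  have e1 : H ^ 2 * T = D * (H * s) := by
    rw [hT, ← hss]; field_simp
  have e2 : 4 * H * D ^ 2 / T = 4 * (D * (H * s)) := by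
    rw [hT]; field_simp
  rw [e2] at hlarge
  have e3 : 8 * q.divisors.card * (H ^ 2 * (T + 4 * D ^ 2 / q)) =
      q.divisors.card * (8 * (D * (H * s)) + 32 * (H ^ 2 * D ^ 2 / q)) := by
    rw [← e1]; ring
  rw [e3] at hsmall
  have e4 : 4 * (D * (H * s)) ≤ q.divisors.card * (4 * (D * (H * s))) :=
    le_mul_of_one_le_left (by positivity) hτ
  linarith

/-! ### Fourier analysis on `ZMod q`. -/

-- Parseval's identity, by orthogonality of the additive characters.
open ZMod in
theorem sum_norm_sq_sum_mul_stdAddChar {q : ℕ} [NeZero q] (f : ZMod q → ℂ) :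
    ∑ h : ZMod q, ‖∑ a, f a * stdAddChar (h * a)‖ ^ 2 = q * ∑ a, ‖f a‖ ^ 2 := by
  have hC : ∀ z : ℂ, ((‖z‖ ^ 2 : ℝ) : ℂ) = z * (starRingEnd ℂ) z := fun z => by
    rw [Complex.mul_conj, Complex.normSq_eq_norm_sq]
  have key : ((∑ h : ZMod q, ‖∑ a, f a * stdAddChar (h * a)‖ ^ 2 : ℝ) : ℂ) =
      ((q * ∑ a, ‖f a‖ ^ 2 : ℝ) : ℂ) := by
    rw [Complex.ofReal_sum]
    simp_rw [hC, map_sum, Finset.sum_mul_sum]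
    rw [Finset.sum_comm]
    push_cast
    rw [Finset.mul_sum]
    refine Finset.sum_congr rfl fun a _ => ?_
    rw [Finset.sum_comm]
    have hin : ∀ b : ZMod q, ∑ h : ZMod q, f a * stdAddChar (h * a) *
        (starRingEnd ℂ) (f b * stdAddChar (h * b)) =
        f a * (starRingEnd ℂ) (f b) * (if a - b = 0 then (q : ℂ) else 0) := by
      intro b
      have h1 := AddChar.sum_mulShift (R := ZMod q) (R' := ℂ) (a - b)
        (ZMod.isPrimitive_stdAddChar q)
      rw [ZMod.card] at h1
      have h2 : (if a - b = 0 then (q : ℂ) else 0) =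
          ∑ h : ZMod q, stdAddChar (h * (a - b)) := by
        rw [h1]; split_ifs <;> simp
      rw [h2, Finset.mul_sum]
      refine Finset.sum_congr rfl fun h _ => ?_
      rw [map_mul (starRingEnd ℂ), mul_sub, sub_eq_add_neg, AddChar.map_add_eq_mul, AddChar.map_neg_eq_conj]
      ring
    simp_rw [hin, sub_eq_zero]
    rw [Finset.sum_eq_single a]
    · rw [if_pos rfl, ← hC]; push_cast; ring
    · intro b _ hb; rw [if_neg (Ne.symm hb), mul_zero]
    · simp
  exact_mod_cast key

-- The left factor comes from `|e(k / q) - 1| = 2 |sin (π k / q)|` and Jordan's inequality,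
-- available because the least absolute representative is at most `q / 2` in size. This gives `4` in
-- place of `2`; the weaker form still cancels the `2` bounding the numerator of a geometric sum.
open ZMod in
theorem norm_stdAddChar_sub_one_ge {q : ℕ} [NeZero q] (k : ZMod q) :
    2 * (zdist k : ℝ) / q ≤ ‖stdAddChar k - 1‖ := by
  have hq : (0 : ℝ) < q := by exact_mod_cast Nat.pos_of_ne_zero (NeZero.ne q)
  have h1 : stdAddChar k =
      Complex.exp (Complex.I * ((2 * Real.pi * (k.valMinAbs : ℝ) / q : ℝ) : ℂ)) := by
    conv_lhs => rw [← ZMod.coe_valMinAbs k]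
    rw [ZMod.stdAddChar_coe]
    congr 1
    push_cast
    ring
  have h2 : (zdist k : ℝ) = |(k.valMinAbs : ℝ)| := by
    rw [zdist, Nat.cast_natAbs, Int.cast_abs]
  have h3 : (zdist k : ℝ) ≤ q / 2 := by
    have := ZMod.natAbs_valMinAbs_le k
    have h4 : zdist k * 2 ≤ q := by rw [zdist]; omega
    rw [le_div_iff₀ (by norm_num)]
    exact_mod_cast h4
  have h5 : |Real.pi * (k.valMinAbs : ℝ) / q| = Real.pi * zdist k / q := by
    rw [abs_div, abs_mul, abs_of_pos Real.pi_pos, abs_of_pos hq, h2]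
  have h6 := Real.mul_abs_le_abs_sin (x := Real.pi * (k.valMinAbs : ℝ) / q) (by
    rw [h5, div_le_div_iff₀ hq (by norm_num)]
    nlinarith [Real.pi_pos])
  rw [h5] at h6
  rw [h1, Complex.norm_exp_I_mul_ofReal_sub_one, Real.norm_eq_abs, abs_mul, abs_two]
  have e : 2 * Real.pi * (k.valMinAbs : ℝ) / q / 2 = Real.pi * (k.valMinAbs : ℝ) / q := by ring
  rw [e]
  have e2 : 2 / Real.pi * (Real.pi * zdist k / q) = 2 * (zdist k : ℝ) / q := by
    field_simp
  rw [e2] at h6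
  have := abs_nonneg (Real.sin (Real.pi * (k.valMinAbs : ℝ) / q))
  linarith

theorem zdist_pos {q : ℕ} {k : ZMod q} (hk : k ≠ 0) : 0 < zdist k := by
  rw [zdist, Int.natAbs_pos, Ne, ZMod.valMinAbs_eq_zero]; exact hk

open ZMod in
theorem norm_sum_stdAddChar_le {q : ℕ} [NeZero q] {k : ZMod q} (hk : k ≠ 0) (N : ℕ) :
    ‖∑ m ∈ Finset.Icc 1 N, stdAddChar ((m : ZMod q) * k)‖ ≤ q / zdist k := by
  have hq : (0 : ℝ) < q := by exact_mod_cast Nat.pos_of_ne_zero (NeZero.ne q)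
  have hz : (0 : ℝ) < zdist k := by exact_mod_cast zdist_pos hk
  have h1 : ∀ m : ℕ, stdAddChar ((m : ZMod q) * k) = (stdAddChar k : ℂ) ^ m := fun m => by
    rw [← nsmul_eq_mul, AddChar.map_nsmul_eq_pow]
  simp_rw [h1]
  have h2 : (∑ m ∈ Finset.Icc 1 N, (stdAddChar k : ℂ) ^ m) * (stdAddChar k - 1) =
      (stdAddChar k : ℂ) ^ (N + 1) - stdAddChar k := by
    induction N with
    | zero => simp
    | succ n ih => rw [Finset.sum_Icc_succ_top (by omega), add_mul, ih]; ring
  have h3 : ‖∑ m ∈ Finset.Icc 1 N, (stdAddChar k : ℂ) ^ m‖ * ‖stdAddChar k - 1‖ ≤ 2 := by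
    rw [← norm_mul, h2]
    refine (norm_sub_le _ _).trans ?_
    rw [norm_pow, AddChar.norm_apply]; norm_num
  have h4 := norm_stdAddChar_sub_one_ge k
  have h5 : ‖∑ m ∈ Finset.Icc 1 N, (stdAddChar k : ℂ) ^ m‖ * (2 * (zdist k : ℝ) / q) ≤ 2 :=
    (mul_le_mul_of_nonneg_left h4 (norm_nonneg _)).trans h3
  rw [le_div_iff₀ hz]
  have h6 : ‖∑ m ∈ Finset.Icc 1 N, (stdAddChar k : ℂ) ^ m‖ * (2 * (zdist k : ℝ) / q) =
    2 * (‖∑ m ∈ Finset.Icc 1 N, (stdAddChar k : ℂ) ^ m‖ * zdist k) / q := by ring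
  rw [h6, div_le_iff₀ hq] at h5
  linarith

/-! ### The Fourier transform of the small part. -/

/-- The number of positive integers `m ≤ x / d ^ 2` with `m * d ^ 2 ≡ a` modulo `q`. -/
noncomputable def sqMultiplesCount (x : ℝ) (q d : ℕ) (a : ZMod q) : ℕ :=
  ((Finset.Icc 1 ⌊x / d ^ 2⌋₊).filter (fun m : ℕ => (m : ZMod q) * (d : ZMod q) ^ 2 = a)).card

/-- The contribution to `E x q a` of the square divisors `d ^ 2` with `d ≤ n`. -/
noncomputable def smallPart (x : ℝ) (q n : ℕ) (a : ZMod q) : ℝ :=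
  ∑ d ∈ (Finset.Icc 1 n).filter (Nat.Coprime · q),
    (ArithmeticFunction.moebius d : ℝ) * (sqMultiplesCount x q d a - x / d ^ 2 / q)

/-- The standard bound for the Fourier coefficient at `h` of the term `d` of `smallPart`. -/
noncomputable def freqBound (x : ℝ) {q : ℕ} (h : ZMod q) (d : ℕ) : ℝ :=
  min (x / d ^ 2) (q / zdist (h * (d : ZMod q) ^ 2))

-- The count becomes a geometric sum over `m`, while the expected value, constant in `a`, survives
-- only at `h = 0`.
open ZMod in
theorem sum_smallPart_mul_stdAddChar (x : ℝ) {q : ℕ} [NeZero q] (n : ℕ) (h : ZMod q) :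
    ∑ a, (smallPart x q n a : ℂ) * stdAddChar (h * a) =
      ∑ d ∈ (Finset.Icc 1 n).filter (Nat.Coprime · q), (ArithmeticFunction.moebius d : ℂ) *
        (∑ m ∈ Finset.Icc 1 ⌊x / d ^ 2⌋₊, stdAddChar ((m : ZMod q) * (h * (d : ZMod q) ^ 2)) -
          (if h = 0 then ((x / d ^ 2 : ℝ) : ℂ) else 0)) := by
  have hq : (q : ℂ) ≠ 0 := by exact_mod_cast NeZero.ne q
  simp_rw [smallPart, Complex.ofReal_sum, Finset.sum_mul]
  rw [Finset.sum_comm]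
  refine Finset.sum_congr rfl fun d _ => ?_
  push_cast
  simp_rw [mul_assoc, ← Finset.mul_sum, sub_mul]
  rw [Finset.sum_sub_distrib]
  congr 2
  · simp_rw [sqMultiplesCount, Finset.card_filter]
    push_cast
    simp_rw [Finset.sum_mul]
    rw [Finset.sum_comm]
    refine Finset.sum_congr rfl fun m _ => ?_
    simp_rw [ite_mul, one_mul, zero_mul]
    rw [Finset.sum_ite_eq]
    simp only [Finset.mem_univ, if_true]
    congr 1; ring
  · rw [← Finset.mul_sum]
    have h1 := AddChar.sum_mulShift (R := ZMod q) (R' := ℂ) h (ZMod.isPrimitive_stdAddChar q)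
    simp_rw [mul_comm _ h] at h1
    rw [h1, ZMod.card]
    split_ifs
    · field_simp
    · simp

theorem norm_moebius_le_one (d : ℕ) : ‖(ArithmeticFunction.moebius d : ℂ)‖ ≤ 1 := by
  rw [Complex.norm_intCast]
  exact_mod_cast ArithmeticFunction.abs_moebius_le_one

open ZMod in
theorem norm_sum_smallPart_le {x : ℝ} {q : ℕ} [NeZero q] (n : ℕ) (hx : 0 ≤ x) {h : ZMod q}
    (hh : h ≠ 0) :
    ‖∑ a, (smallPart x q n a : ℂ) * stdAddChar (h * a)‖ ≤
      ∑ d ∈ (Finset.Icc 1 n).filter (Nat.Coprime · q), freqBound x h d := by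
  rw [sum_smallPart_mul_stdAddChar]
  refine norm_sum_le_of_le _ fun d hd => ?_
  have hc := (Finset.mem_filter.mp hd).2
  rw [if_neg hh, sub_zero, norm_mul]
  refine (mul_le_of_le_one_left (norm_nonneg _) (norm_moebius_le_one d)).trans (le_min ?_ ?_)
  · refine (norm_sum_le _ _).trans ?_
    simp_rw [AddChar.norm_apply]
    rw [Finset.sum_const, Nat.card_Icc, Nat.add_sub_cancel, nsmul_one]
    exact Nat.floor_le (by positivity)
  · refine norm_sum_stdAddChar_le ?_ _
    rw [Ne, (isUnit_natCast_sq hc).mul_left_eq_zero]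
    exact hh

-- At frequency `0` each `d` leaves only the error of rounding `x / d ^ 2` down, which is at most
-- `1`.
open ZMod in
theorem norm_sum_smallPart_zero_le {x : ℝ} {q : ℕ} [NeZero q] (n : ℕ) (hx : 0 ≤ x) :
    ‖∑ a, (smallPart x q n a : ℂ) * stdAddChar ((0 : ZMod q) * a)‖ ≤ n := by
  rw [sum_smallPart_mul_stdAddChar]
  calc _ ≤ ∑ d ∈ (Finset.Icc 1 n).filter (Nat.Coprime · q), (1 : ℝ) := by
        refine norm_sum_le_of_le _ fun d hd => ?_
        rw [if_pos rfl, norm_mul]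
        refine (mul_le_of_le_one_left (norm_nonneg _) (norm_moebius_le_one d)).trans ?_
        simp only [zero_mul, mul_zero, AddChar.map_zero_eq_one, Finset.sum_const, Nat.card_Icc,
          Nat.add_sub_cancel, nsmul_one]
        have e : ((⌊x / (d : ℝ) ^ 2⌋₊ : ℂ) - ((x / (d : ℝ) ^ 2 : ℝ) : ℂ)) =
          ((⌊x / (d : ℝ) ^ 2⌋₊ - x / (d : ℝ) ^ 2 : ℝ) : ℂ) := by push_cast; ring
        rw [e, Complex.norm_real, Real.norm_eq_abs, abs_le]
        have h1 := Nat.floor_le (show 0 ≤ x / (d : ℝ) ^ 2 by positivity)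
        have h2 := Nat.lt_floor_add_one (x / (d : ℝ) ^ 2)
        constructor <;> linarith
    _ = (((Finset.Icc 1 n).filter (Nat.Coprime · q)).card : ℝ) := by simp
    _ ≤ n := by
        have := Finset.card_filter_le (Finset.Icc 1 n) (Nat.Coprime · q)
        rw [Nat.card_Icc, Nat.add_sub_cancel] at this
        exact_mod_cast this

/-! ### Dyadic decomposition and the second moment. -/

/-- The single term `j = Nat.log 2 ⌊w⌋₊` already dominates `w`. -/
theorem le_two_mul_sum_two_pow {x w : ℝ} (hw : 1 ≤ w) (hwx : w ≤ x) :
    w ≤ ∑ j ∈ Finset.range (Nat.log 2 ⌊x⌋₊ + 1), if (2 : ℝ) ^ j ≤ w then 2 * 2 ^ j else 0 := by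
  set i := Nat.log 2 ⌊w⌋₊ with hi
  have hi1 : i ∈ Finset.range (Nat.log 2 ⌊x⌋₊ + 1) :=
    Finset.mem_range.mpr (Nat.lt_succ_of_le (Nat.log_mono_right (Nat.floor_le_floor hwx)))
  have h1 : (2 : ℝ) ^ i ≤ w := by
    have : 2 ^ i ≤ ⌊w⌋₊ := Nat.pow_log_le_self 2 (Nat.floor_pos.mpr hw).ne'
    calc (2 : ℝ) ^ i ≤ (⌊w⌋₊ : ℝ) := by exact_mod_cast this
      _ ≤ w := Nat.floor_le (by linarith)
  have h2 : w ≤ 2 * 2 ^ i := by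
    have h3 : ⌊w⌋₊ < 2 ^ (i + 1) := Nat.lt_pow_succ_log_self one_lt_two _
    have h4 : ((⌊w⌋₊ + 1 : ℕ) : ℝ) ≤ ((2 ^ (i + 1) : ℕ) : ℝ) := by exact_mod_cast h3
    push_cast at h4
    rw [pow_succ] at h4
    linarith [Nat.lt_floor_add_one w]
  calc w ≤ if (2 : ℝ) ^ i ≤ w then 2 * 2 ^ i else 0 := by rw [if_pos h1]; exact h2
    _ ≤ _ := Finset.single_le_sum
      (f := fun j : ℕ => if (2 : ℝ) ^ j ≤ w then 2 * (2 : ℝ) ^ j else 0)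
      (fun j _ => by split_ifs <;> positivity) hi1

/-- The `d ≤ n` prime to `q` for which the bound `freqBound x h d` is at least `2 ^ j`. -/
noncomputable def dyadicSet (x : ℝ) {q : ℕ} (n : ℕ) (h : ZMod q) (j : ℕ) : Finset ℕ :=
  ((Finset.Icc 1 n).filter (Nat.Coprime · q)).filter (fun d => (2 : ℝ) ^ j ≤ freqBound x h d)

theorem sum_freqBound_le {x : ℝ} {q : ℕ} [NeZero q] {n : ℕ} (hn : (n : ℝ) ^ 2 ≤ x) {h : ZMod q}
    (hh : h ≠ 0) :
    ∑ d ∈ (Finset.Icc 1 n).filter (Nat.Coprime · q), freqBound x h d ≤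
      ∑ j ∈ Finset.range (Nat.log 2 ⌊x⌋₊ + 1), 2 * 2 ^ j * ((dyadicSet x n h j).card : ℝ) := by
  have hx : 0 ≤ x := le_trans (by positivity) hn
  calc ∑ d ∈ (Finset.Icc 1 n).filter (Nat.Coprime · q), freqBound x h d
      ≤ ∑ d ∈ (Finset.Icc 1 n).filter (Nat.Coprime · q),
        ∑ j ∈ Finset.range (Nat.log 2 ⌊x⌋₊ + 1),
          if (2 : ℝ) ^ j ≤ freqBound x h d then 2 * 2 ^ j else 0 := by
        refine Finset.sum_le_sum fun d hd => ?_
        obtain ⟨h1, hc⟩ := Finset.mem_filter.mp hd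
        obtain ⟨h2, h3⟩ := Finset.mem_Icc.mp h1
        have hd1 : (1 : ℝ) ≤ d := by exact_mod_cast h2
        have hdn : (d : ℝ) ≤ n := by exact_mod_cast h3
        have hd2 : (d : ℝ) ^ 2 ≤ x := le_trans (by gcongr) hn
        -- The splitting needs `1 ≤ freqBound x h d ≤ x`: the lower bound uses `d ^ 2 ≤ x` and
        -- `zdist ≤ q`, the upper one `1 ≤ d`.
        refine le_two_mul_sum_two_pow (le_min ?_ ?_) ((min_le_left _ _).trans ?_)
        · rwa [one_le_div (by positivity)]
        · have hz : 0 < zdist (h * (d : ZMod q) ^ 2) := zdist_pos (by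
            rw [Ne, (isUnit_natCast_sq hc).mul_left_eq_zero]; exact hh)
          rw [one_le_div (by exact_mod_cast hz)]
          have := ZMod.natAbs_valMinAbs_le (h * (d : ZMod q) ^ 2)
          have : zdist (h * (d : ZMod q) ^ 2) ≤ q := by rw [zdist]; omega
          exact_mod_cast this
        · exact div_le_self hx (one_le_pow₀ hd1)
    _ = _ := by
        rw [Finset.sum_comm]
        refine Finset.sum_congr rfl fun j _ => ?_
        rw [← Finset.sum_filter, Finset.sum_const, nsmul_eq_mul, mul_comm]
        rfl

/-- The square counts pairs `(d, d')` at the same `h`. Each half of the minimum in `freqBound` being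
at least `2 ^ j` gives one condition: `d ≤ √(x / 2 ^ j)` and `zdist (h d ^ 2) ≤ q / 2 ^ j`. -/
theorem sum_card_dyadicSet_sq_le {x : ℝ} {q : ℕ} [NeZero q] (n : ℕ) (j : ℕ) :
    ∑ h ∈ Finset.univ.filter (fun h : ZMod q => h ≠ 0), (dyadicSet x n h j).card ^ 2 ≤
      (allTriples q (q / 2 ^ j) (min n √(x / 2 ^ j))).card := by
  have e : ∑ h ∈ Finset.univ.filter (fun h : ZMod q => h ≠ 0), (dyadicSet x n h j).card ^ 2 =
      ((Finset.univ.filter (fun h : ZMod q => h ≠ 0)).sigma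
        (fun h => dyadicSet x n h j ×ˢ dyadicSet x n h j)).card := by
    rw [Finset.card_sigma]
    exact Finset.sum_congr rfl fun h _ => by rw [Finset.card_product, sq]
  rw [e]
  refine Finset.card_le_card_of_injOn (fun t => (t.1, t.2)) (fun t ht => ?_)
    (fun t _ s _ hts => ?_)
  · obtain ⟨h, d, d'⟩ := t
    have key : ∀ d ∈ dyadicSet x n h j, ((1 ≤ d ∧ d ≤ ⌊min (n : ℝ) √(x / 2 ^ j)⌋₊) ∧
        d.Coprime q) ∧ ((h ≠ 0) → (zdist (h * (d : ZMod q) ^ 2) : ℝ) ≤ q / 2 ^ j) := by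
      intro d hd
      obtain ⟨hd1, hd2⟩ := Finset.mem_filter.mp hd
      obtain ⟨hd3, hc⟩ := Finset.mem_filter.mp hd1
      obtain ⟨hd4, hd5⟩ := Finset.mem_Icc.mp hd3
      obtain ⟨g1, g2⟩ := le_min_iff.mp hd2
      have hd0 : (0 : ℝ) < d := by exact_mod_cast hd4
      refine ⟨⟨⟨hd4, Nat.le_floor (le_min (by exact_mod_cast hd5) ?_)⟩, hc⟩, fun hh => ?_⟩
      · refine Real.le_sqrt_of_sq_le ?_
        rw [le_div_iff₀ (by positivity)] at g1 ⊢
        linarith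
      · have hz : 0 < zdist (h * (d : ZMod q) ^ 2) := zdist_pos (by
          rw [Ne, (isUnit_natCast_sq hc).mul_left_eq_zero]; exact hh)
        have hz' : (0 : ℝ) < zdist (h * (d : ZMod q) ^ 2) := by exact_mod_cast hz
        rw [le_div_iff₀ hz'] at g2
        rw [le_div_iff₀ (by positivity)]
        linarith
    simp only [Finset.mem_coe, Finset.mem_sigma, Finset.mem_filter, Finset.mem_univ, true_and,
      Finset.mem_product] at ht
    obtain ⟨hh, m1, m2⟩ := ht
    rw [Finset.mem_coe, mem_allTriples]
    exact ⟨⟨(key d m1).1, (key d' m2).1⟩, hh, (key d m1).2 hh, (key d' m2).2 hh⟩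
  · obtain ⟨h, p⟩ := t
    obtain ⟨h', p'⟩ := s
    simp only [Prod.mk.injEq] at hts
    obtain ⟨rfl, rfl⟩ := hts
    rfl

/-- The powers of `2` cancel, so every dyadic level obeys the same bound. The term linear in `D`
uses `D ≤ √(x / 2 ^ j)`, the quadratic one uses `D ≤ n`. -/
theorem four_pow_mul_card_allTriples_le {x : ℝ} {q : ℕ} [NeZero q] {n : ℕ} (hn0 : 0 < n)
    (hx : 0 < x) (hn : (n : ℝ) ^ 2 * √q ≤ x) (j : ℕ) :
    4 ^ j * ((allTriples q (q / 2 ^ j) (min n √(x / 2 ^ j))).card : ℝ) ≤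
      32 * q.divisors.card * (√x * (q * √q) + x * √q) := by
  have hq : (0 : ℝ) < q := by exact_mod_cast Nat.pos_of_ne_zero (NeZero.ne q)
  have hn0' : (0 : ℝ) < n := by exact_mod_cast hn0
  set D : ℝ := min n √(x / 2 ^ j) with hD
  have hD0 : 0 < D := lt_min hn0' (by positivity)
  have h := card_allTriples_le q (H := q / 2 ^ j) (D := D) (by positivity) hD0
  have h4 : (4 : ℝ) ^ j = 2 ^ j * 2 ^ j := by rw [← mul_pow]; norm_num
  have e1 : 4 ^ j * (D * ((q / 2 ^ j : ℝ) * √(q / 2 ^ j))) ≤ √x * (q * √q) := by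
    calc _ ≤ 4 ^ j * (√(x / 2 ^ j) * ((q / 2 ^ j : ℝ) * √(q / 2 ^ j))) := by
          gcongr; exact min_le_right _ _
      _ = √x * (q * √q) := by
          rw [Real.sqrt_div hx.le, Real.sqrt_div hq.le, h4]
          have hs : (2 : ℝ) ^ j = √((2 : ℝ) ^ j) * √((2 : ℝ) ^ j) :=
            (Real.mul_self_sqrt (by positivity)).symm
          have hs0 : √((2 : ℝ) ^ j) ≠ 0 := (Real.sqrt_pos.mpr (by positivity)).ne'
          generalize √((2 : ℝ) ^ j) = r at hs hs0 ⊢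
          rw [hs]
          field_simp
  have e2 : 4 ^ j * ((q / 2 ^ j : ℝ) ^ 2 * D ^ 2 / q) ≤ x * √q := by
    calc _ ≤ 4 ^ j * ((q / 2 ^ j : ℝ) ^ 2 * n ^ 2 / q) := by gcongr; exact min_le_left _ _
      _ = q * n ^ 2 := by rw [h4]; field_simp
      _ = ((n : ℝ) ^ 2 * √q) * √q := by
          rw [mul_assoc, Real.mul_self_sqrt hq.le]; ring
      _ ≤ x * √q := by gcongr
  calc _ ≤ 4 ^ j * (q.divisors.card * (12 * (D * ((q / 2 ^ j : ℝ) * √(q / 2 ^ j))) +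
        32 * ((q / 2 ^ j : ℝ) ^ 2 * D ^ 2 / q))) := by gcongr
    _ = q.divisors.card * (12 * (4 ^ j * (D * ((q / 2 ^ j : ℝ) * √(q / 2 ^ j)))) +
        32 * (4 ^ j * ((q / 2 ^ j : ℝ) ^ 2 * D ^ 2 / q))) := by ring
    _ ≤ q.divisors.card * (32 * (√x * (q * √q)) + 32 * (x * √q)) := by
        have : 0 ≤ √x * (q * √q) := by positivity
        gcongr
        linarith
    _ = _ := by ring

/-- The factor `q` from Cauchy–Schwarz over the classes is exactly the one in Parseval. A second
Cauchy–Schwarz, over the `L` dyadic levels, and a sum of `L` equal bounds give `L ^ 2`. The constant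
is `4 * 32` from nonzero frequencies plus `1` from frequency `0`, where `n ^ 2 ≤ x ≤ Y`. -/
theorem sq_sum_abs_smallPart_le {x : ℝ} {q : ℕ} [NeZero q] {n : ℕ} (hn0 : 0 < n)
    (hx : 1 ≤ x) (hn : (n : ℝ) ^ 2 * √q ≤ x) :
    (∑ a : ZMod q, |smallPart x q n a|) ^ 2 ≤
      129 * ((Nat.log 2 ⌊x⌋₊ + 1 : ℕ) : ℝ) ^ 2 * q.divisors.card *
        (√x * (q * √q) + x * √q) := by
  have hx0 : 0 < x := by linarith
  have hq1 : (1 : ℝ) ≤ q := by exact_mod_cast Nat.pos_of_ne_zero (NeZero.ne q)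
  have hsq1 : 1 ≤ √(q : ℝ) := Real.one_le_sqrt.mpr hq1
  have hn2 : (n : ℝ) ^ 2 ≤ x := le_trans (le_mul_of_one_le_right (by positivity) hsq1) hn
  have hτ : (1 : ℝ) ≤ q.divisors.card := by
    exact_mod_cast Finset.card_pos.mpr (Nat.nonempty_divisors.mpr (NeZero.ne q))
  set L : ℕ := Nat.log 2 ⌊x⌋₊ + 1 with hL
  have hL1 : (1 : ℝ) ≤ L := by rw [hL]; push_cast; linarith [Nat.cast_nonneg (α := ℝ) (Nat.log 2 ⌊x⌋₊)]
  set Y : ℝ := √x * (q * √q) + x * √q with hY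
  have hYx : x ≤ Y := by
    have h1 : x ≤ x * √q := le_mul_of_one_le_right hx0.le hsq1
    have h2 : 0 ≤ √x * (q * √q) := by positivity
    linarith
  have hnz : ∑ h ∈ Finset.univ.filter (fun h : ZMod q => h ≠ 0),
      ‖∑ a, (smallPart x q n a : ℂ) * ZMod.stdAddChar (h * a)‖ ^ 2 ≤
      128 * (L : ℝ) ^ 2 * q.divisors.card * Y := by
    calc _ ≤ ∑ h ∈ Finset.univ.filter (fun h : ZMod q => h ≠ 0),
          (L : ℝ) * ∑ j ∈ Finset.range L, (2 * 2 ^ j * ((dyadicSet x n h j).card : ℝ)) ^ 2 := by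
          refine Finset.sum_le_sum fun h hh => ?_
          have hh' := (Finset.mem_filter.mp hh).2
          have h1 := (norm_sum_smallPart_le n hx0.le hh').trans (sum_freqBound_le hn2 hh')
          refine (pow_le_pow_left₀ (norm_nonneg _) h1 2).trans ?_
          refine sq_sum_le_card_mul_sum_sq.trans_eq ?_
          rw [Finset.card_range]
      _ = (L : ℝ) * ∑ j ∈ Finset.range L, 4 * (4 ^ j *
          ((∑ h ∈ Finset.univ.filter (fun h : ZMod q => h ≠ 0),
            (dyadicSet x n h j).card ^ 2 : ℕ) : ℝ)) := by
          rw [← Finset.mul_sum, Finset.sum_comm]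
          congr 1
          refine Finset.sum_congr rfl fun j _ => ?_
          push_cast
          rw [Finset.mul_sum, Finset.mul_sum]
          refine Finset.sum_congr rfl fun h _ => ?_
          have h4 : (4 : ℝ) ^ j = 2 ^ j * 2 ^ j := by rw [← mul_pow]; norm_num
          rw [h4]; ring
      _ ≤ (L : ℝ) * ∑ _j ∈ Finset.range L, 4 * (32 * q.divisors.card * Y) := by
          refine mul_le_mul_of_nonneg_left (Finset.sum_le_sum fun j _ => ?_) (Nat.cast_nonneg L)
          refine mul_le_mul_of_nonneg_left ?_ zero_le_four
          refine le_trans ?_ (four_pow_mul_card_allTriples_le hn0 hx0 hn j)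
          exact mul_le_mul_of_nonneg_left (Nat.cast_le.mpr (sum_card_dyadicSet_sq_le n j))
            (by positivity)
      _ = _ := by rw [Finset.sum_const, Finset.card_range, nsmul_eq_mul]; ring
  clear_value L Y
  have hz : ‖∑ a, (smallPart x q n a : ℂ) * ZMod.stdAddChar ((0 : ZMod q) * a)‖ ^ 2 ≤
      (L : ℝ) ^ 2 * q.divisors.card * Y := by
    have h1 : ‖∑ a, (smallPart x q n a : ℂ) * ZMod.stdAddChar ((0 : ZMod q) * a)‖ ^ 2 ≤
        (n : ℝ) ^ 2 := by
      have h0 := norm_sum_smallPart_zero_le (x := x) (q := q) n hx0.le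
      gcongr
    have h2 : Y ≤ (L : ℝ) ^ 2 * q.divisors.card * Y :=
      le_mul_of_one_le_left (by linarith) (one_le_mul_of_one_le_of_one_le (one_le_pow₀ hL1) hτ)
    linarith
  have hP := sum_norm_sq_sum_mul_stdAddChar (fun a : ZMod q => (smallPart x q n a : ℂ))
  have hsplit := Finset.sum_filter_add_sum_filter_not Finset.univ (fun h : ZMod q => h ≠ 0)
    (fun h => ‖∑ a, (smallPart x q n a : ℂ) * ZMod.stdAddChar (h * a)‖ ^ 2)
  have hsing : Finset.univ.filter (fun h : ZMod q => ¬ h ≠ 0) = {0} := by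
    ext h; simp
  rw [hsing, Finset.sum_singleton] at hsplit
  have hC : (∑ a : ZMod q, |smallPart x q n a|) ^ 2 ≤
      q * ∑ a : ZMod q, ‖(smallPart x q n a : ℂ)‖ ^ 2 := by
    refine sq_sum_le_card_mul_sum_sq.trans_eq ?_
    rw [Finset.card_univ, ZMod.card]
    simp_rw [Complex.norm_real, Real.norm_eq_abs]
  rw [← hP, ← hsplit] at hC
  linarith

/-! ### Square divisors and the series for `c_q`. -/

/-- Divide `d` and `b` by their gcd: what remains of `d` has its square dividing the squarefree `a`,
so it is `1`. -/
theorem dvd_of_sq_dvd_sq_mul_squarefree {a b d : ℕ} (hb : 0 < b) (ha : Squarefree a)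
    (h : d ^ 2 ∣ b ^ 2 * a) : d ∣ b := by
  have hg : 0 < Nat.gcd d b := Nat.gcd_pos_of_pos_right _ hb
  obtain ⟨d', hd'⟩ := Nat.gcd_dvd_left d b
  obtain ⟨b', hb'⟩ := Nat.gcd_dvd_right d b
  have hc : d'.Coprime b' := by
    have := Nat.coprime_div_gcd_div_gcd hg
    rwa [Nat.div_eq_of_eq_mul_right hg hd', Nat.div_eq_of_eq_mul_right hg hb'] at this
  have h1 : Nat.gcd d b ^ 2 * d' ^ 2 ∣ Nat.gcd d b ^ 2 * (b' ^ 2 * a) := by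
    rw [← mul_assoc, ← mul_pow, ← mul_pow, ← hd', ← hb']; exact h
  have h2 : d' ^ 2 ∣ b' ^ 2 * a := Nat.dvd_of_mul_dvd_mul_left (by positivity) h1
  have h3 : d' ^ 2 ∣ a := (hc.pow 2 2).dvd_of_dvd_mul_left h2
  have h4 : d' = 1 := Nat.isUnit_iff.mp (ha d' (by rwa [← sq]))
  rw [h4, mul_one] at hd'
  rw [hd']
  exact Nat.gcd_dvd_right d b

/-- Write `n = b ^ 2 a` with `a` squarefree. Then `d ^ 2 ∣ n` exactly when `d ∣ b`, and the sum of
`μ` over the divisors of `b` detects `b = 1`. Any range reaching `n` contains these `d`, so one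
range serves all `n ≤ x`. -/
theorem abs_moebius_eq_sum {n R : ℕ} (hn : 0 < n) (hR : n ≤ R) :
    |ArithmeticFunction.moebius n| =
      ∑ d ∈ (Finset.Icc 1 R).filter (fun d => d ^ 2 ∣ n), ArithmeticFunction.moebius d := by
  obtain ⟨a, b, ha, hb, hab, hsq⟩ := Nat.sq_mul_squarefree_of_pos hn
  have hset : (Finset.Icc 1 R).filter (fun d => d ^ 2 ∣ n) = b.divisors := by
    ext d
    rw [Finset.mem_filter, Finset.mem_Icc, Nat.mem_divisors]
    constructor
    · rintro ⟨-, h⟩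
      exact ⟨dvd_of_sq_dvd_sq_mul_squarefree hb hsq (hab ▸ h), hb.ne'⟩
    · rintro ⟨h, -⟩
      have h2 : d ^ 2 ∣ n := hab ▸ (pow_dvd_pow_of_dvd h 2).mul_right a
      have h3 : d ≤ d ^ 2 := Nat.le_self_pow two_ne_zero d
      exact ⟨⟨Nat.pos_of_dvd_of_pos h hb, h3.trans ((Nat.le_of_dvd hn h2).trans hR)⟩, h2⟩
  have hsum : ∑ d ∈ b.divisors, ArithmeticFunction.moebius d = if b = 1 then 1 else 0 := by
    rw [← ArithmeticFunction.coe_zeta_mul_apply, ArithmeticFunction.coe_zeta_mul_moebius,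
      ArithmeticFunction.one_apply]
  rw [hset, hsum]
  split_ifs with h1
  · rw [h1, one_pow, one_mul] at hab
    rw [← hab]
    exact ArithmeticFunction.abs_moebius_eq_one_of_squarefree hsq
  · have : ¬ Squarefree n := fun hs => h1 (Nat.isUnit_iff.mp (hs b ⟨a, by rw [← hab]; ring⟩))
    rw [ArithmeticFunction.moebius_eq_zero_of_not_squarefree this, abs_zero]

theorem card_filter_sq_dvd {x : ℝ} {q : ℕ} (a : ZMod q) {d : ℕ} (hd : 0 < d) :
    ((Finset.Icc 1 ⌊x⌋₊).filter (fun n : ℕ => (n : ZMod q) = a ∧ d ^ 2 ∣ n)).card =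
      sqMultiplesCount x q d a := by
  have hfl : ⌊x / (d : ℝ) ^ 2⌋₊ = ⌊x⌋₊ / d ^ 2 := by
    rw [← Nat.floor_div_natCast]; push_cast; rfl
  rw [sqMultiplesCount, hfl]
  symm
  refine Finset.card_bij (fun m _ => m * d ^ 2) (fun m hm => ?_) (fun m _ k _ h => ?_)
    (fun n hn => ?_)
  · obtain ⟨h1, h2⟩ := Finset.mem_filter.mp hm
    obtain ⟨h3, h4⟩ := Finset.mem_Icc.mp h1
    rw [Finset.mem_filter, Finset.mem_Icc]
    refine ⟨⟨Nat.mul_pos h3 (by positivity), (Nat.le_div_iff_mul_le (by positivity)).mp h4⟩,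
      by push_cast; exact h2, Dvd.intro_left _ rfl⟩
  · exact Nat.eq_of_mul_eq_mul_right (by positivity) h
  · obtain ⟨h1, h2, m, rfl⟩ := Finset.mem_filter.mp hn
    obtain ⟨h3, h4⟩ := Finset.mem_Icc.mp h1
    refine ⟨m, ?_, mul_comm _ _⟩
    rw [Finset.mem_filter, Finset.mem_Icc]
    refine ⟨⟨Nat.pos_of_mul_pos_left h3, ?_⟩, ?_⟩
    · rw [Nat.le_div_iff_mul_le (by positivity), mul_comm]; exact h4
    · rw [← h2]; push_cast; ring

theorem sqMultiplesCount_eq_zero {x : ℝ} {q : ℕ} (a : (ZMod q)ˣ) {d : ℕ} (hd : ¬ d.Coprime q) :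
    sqMultiplesCount x q d (a : ZMod q) = 0 := by
  rw [sqMultiplesCount, Finset.card_eq_zero, Finset.filter_eq_empty_iff]
  intro m _ h
  apply hd
  rw [← ZMod.isUnit_iff_coprime]
  have h1 : IsUnit ((m : ZMod q) * (d : ZMod q) ^ 2) := h ▸ a.isUnit
  exact (isUnit_pow_iff two_ne_zero).mp (isUnit_of_mul_isUnit_right h1)

theorem S_eq_sum (x : ℝ) (q : ℕ) (a : (ZMod q)ˣ) :
    S x q (a : ZMod q) = ∑ d ∈ (Finset.Icc 1 ⌊x⌋₊).filter (Nat.Coprime · q),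
      (ArithmeticFunction.moebius d : ℝ) * sqMultiplesCount x q d a := by
  have h1 : ∀ n ∈ (Finset.Icc 1 ⌊x⌋₊).filter (fun n : ℕ => (n : ZMod q) = a),
      |(ArithmeticFunction.moebius n : ℝ)| = ∑ d ∈ Finset.Icc 1 ⌊x⌋₊,
        if d ^ 2 ∣ n then (ArithmeticFunction.moebius d : ℝ) else 0 := by
    intro n hn
    obtain ⟨h2, h3⟩ := Finset.mem_Icc.mp (Finset.mem_filter.mp hn).1
    rw [← Finset.sum_filter, ← Int.cast_abs, abs_moebius_eq_sum h2 h3, Int.cast_sum]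
  rw [S, Finset.sum_congr rfl h1, Finset.sum_comm]
  have h2 : ∀ d ∈ Finset.Icc 1 ⌊x⌋₊,
      ∑ n ∈ (Finset.Icc 1 ⌊x⌋₊).filter (fun n : ℕ => (n : ZMod q) = a),
        (if d ^ 2 ∣ n then (ArithmeticFunction.moebius d : ℝ) else 0) =
      (ArithmeticFunction.moebius d : ℝ) * sqMultiplesCount x q d a := by
    intro d hd
    rw [← Finset.sum_filter, Finset.filter_filter, Finset.sum_const, nsmul_eq_mul, mul_comm,
      card_filter_sq_dvd _ (Finset.mem_Icc.mp hd).1]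
  rw [Finset.sum_congr rfl h2]
  symm
  refine Finset.sum_subset (Finset.filter_subset _ _) fun d hd hd' => ?_
  have hc : ¬ d.Coprime q := fun hc => hd' (Finset.mem_filter.mpr ⟨hd, hc⟩)
  rw [sqMultiplesCount_eq_zero a hc, Nat.cast_zero, mul_zero]

/-- The general term of the Dirichlet series of `c q`. -/
noncomputable def cTerm (q d : ℕ) : ℝ :=
  if d.Coprime q then (ArithmeticFunction.moebius d : ℝ) / (d : ℝ) ^ 2 else 0

theorem abs_cTerm_le (q d : ℕ) : |cTerm q d| ≤ ((d : ℝ) ^ 2)⁻¹ := by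
  unfold cTerm
  split_ifs
  · rw [abs_div, abs_of_nonneg (show (0 : ℝ) ≤ (d : ℝ) ^ 2 by positivity), div_eq_mul_inv]
    refine mul_le_of_le_one_left (by positivity) ?_
    exact_mod_cast ArithmeticFunction.abs_moebius_le_one
  · rw [abs_zero]; positivity

theorem summable_norm_cTerm (q : ℕ) : Summable (fun d => ‖cTerm q d‖) := by
  refine Summable.of_nonneg_of_le (fun _ => norm_nonneg _) (fun d => abs_cTerm_le q d) ?_
  exact Real.summable_nat_pow_inv.mpr one_lt_two

/-- The Euler product of the multiplicative function `cTerm q`; its local series stops after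
exponent `1`, since `μ` vanishes at higher prime powers. -/
theorem c_eq_tsum (q : ℕ) : c q = ∑' d, cTerm q d := by
  have h1 : cTerm q 1 = 1 := by simp [cTerm]
  have hmul : ∀ {m n : ℕ}, m.Coprime n → cTerm q (m * n) = cTerm q m * cTerm q n := by
    intro m n hmn
    unfold cTerm
    rw [ArithmeticFunction.isMultiplicative_moebius.map_mul_of_coprime hmn]
    by_cases hm : m.Coprime q
    · by_cases hn : n.Coprime q
      · rw [if_pos (hm.mul_left hn), if_pos hm, if_pos hn]
        push_cast
        rw [mul_pow, mul_div_mul_comm]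
      · rw [if_neg fun h => hn (Nat.coprime_mul_iff_left.mp h).2, if_neg hn, mul_zero]
    · rw [if_neg fun h => hm (Nat.coprime_mul_iff_left.mp h).1, if_neg hm, zero_mul]
  rw [← EulerProduct.eulerProduct_tprod h1 hmul (summable_norm_cTerm q) (by simp [cTerm]), c]
  congr 1
  funext p
  have hp := p.2
  have hp0 : ∀ e ∉ Finset.range 2, cTerm q ((p : ℕ) ^ e) = 0 := by
    intro e he
    have he2 : 2 ≤ e := not_lt.mp fun h => he (Finset.mem_range.mpr h)
    have : ¬ Squarefree ((p : ℕ) ^ e) := fun hs => by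
      have := (Nat.squarefree_pow_iff hp.one_lt.ne' (by omega)).mp hs
      omega
    simp [cTerm, ArithmeticFunction.moebius_eq_zero_of_not_squarefree this]
  rw [tsum_eq_sum hp0, Finset.sum_range_succ, Finset.sum_range_one, pow_zero, pow_one, h1,
    localFactor, cTerm, ArithmeticFunction.moebius_apply_prime hp]
  by_cases h : (p : ℕ) ∣ q
  · rw [if_pos h, if_neg fun hc => (Nat.Prime.coprime_iff_not_dvd hp).mp hc h, add_zero]
  · rw [if_neg h, if_pos ((Nat.Prime.coprime_iff_not_dvd hp).mpr h)]
    push_cast; ring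

theorem abs_c_sub_sum_le (q : ℕ) {T : ℝ} (hT : 0 < T) :
    |c q - ∑ d ∈ Finset.Icc 1 ⌊T⌋₊, cTerm q d| ≤ 2 / T := by
  have hs : HasSum (cTerm q) (c q) := by
    rw [c_eq_tsum]; exact (summable_norm_cTerm q).of_norm.hasSum
  have hlim := ((hs.sub_const (∑ d ∈ Finset.Icc 1 ⌊T⌋₊, cTerm q d))).abs
  refine le_of_tendsto hlim ?_
  filter_upwards [Filter.eventually_ge_atTop (Finset.Icc 1 ⌊T⌋₊)] with s hs'
  rw [← Finset.sum_sdiff (show Finset.Icc 1 ⌊T⌋₊ ⊆ s from hs'), add_sub_cancel_right]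
  -- The index `0` may lie in `s` but not beyond `T`; its term is zero.
  have h0 : ∑ d ∈ s \ Finset.Icc 1 ⌊T⌋₊, cTerm q d =
      ∑ d ∈ (s \ Finset.Icc 1 ⌊T⌋₊).erase 0, cTerm q d :=
    (Finset.sum_erase _ (by simp [cTerm])).symm
  rw [h0]
  refine (Finset.abs_sum_le_sum_abs _ _).trans
    ((Finset.sum_le_sum fun d _ => abs_cTerm_le q d).trans (sum_inv_sq_le _ hT fun d hd => ?_))
  rw [Finset.mem_erase, Finset.mem_sdiff, Finset.mem_Icc] at hd
  refine (Nat.floor_lt hT.le).mp ?_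
  omega

/-! ### Splitting the error term at `T`. -/

theorem abs_E_le {x T : ℝ} (hT : 0 < T) (hTx : T ≤ x) {q : ℕ} (a : (ZMod q)ˣ) :
    |E x q (a : ZMod q)| ≤ |smallPart x q ⌊T⌋₊ a| +
      ∑ d ∈ Finset.Ioc ⌊T⌋₊ ⌊x⌋₊, (sqMultiplesCount x q d a : ℝ) + x / q * (2 / T) := by
  have hx : 0 ≤ x := hT.le.trans hTx
  have hfl : ⌊T⌋₊ ≤ ⌊x⌋₊ := Nat.floor_le_floor hTx
  have hsplit : (Finset.Icc 1 ⌊x⌋₊).filter (Nat.Coprime · q) =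
      (Finset.Icc 1 ⌊T⌋₊).filter (Nat.Coprime · q) ∪
      (Finset.Ioc ⌊T⌋₊ ⌊x⌋₊).filter (Nat.Coprime · q) := by
    ext d
    simp only [Finset.mem_union, Finset.mem_filter, Finset.mem_Icc, Finset.mem_Ioc]
    constructor
    · rintro ⟨⟨h1, h2⟩, h3⟩
      by_cases h : d ≤ ⌊T⌋₊
      · exact Or.inl ⟨⟨h1, h⟩, h3⟩
      · exact Or.inr ⟨⟨by omega, h2⟩, h3⟩
    · rintro (⟨⟨h1, h2⟩, h3⟩ | ⟨⟨h1, h2⟩, h3⟩)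
      · exact ⟨⟨h1, h2.trans hfl⟩, h3⟩
      · exact ⟨⟨by omega, h2⟩, h3⟩
  have hdisj : Disjoint ((Finset.Icc 1 ⌊T⌋₊).filter (Nat.Coprime · q))
      ((Finset.Ioc ⌊T⌋₊ ⌊x⌋₊).filter (Nat.Coprime · q)) := by
    rw [Finset.disjoint_left]
    intro d h1 h2
    simp only [Finset.mem_filter, Finset.mem_Icc, Finset.mem_Ioc] at h1 h2
    omega
  have hsmall : smallPart x q ⌊T⌋₊ (a : ZMod q) =
      ∑ d ∈ (Finset.Icc 1 ⌊T⌋₊).filter (Nat.Coprime · q),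
        (ArithmeticFunction.moebius d : ℝ) * sqMultiplesCount x q d a -
      x / q * ∑ d ∈ Finset.Icc 1 ⌊T⌋₊, cTerm q d := by
    simp_rw [cTerm]
    rw [← Finset.sum_filter, smallPart, Finset.mul_sum, ← Finset.sum_sub_distrib]
    refine Finset.sum_congr rfl fun d _ => ?_
    ring
  have heq : E x q (a : ZMod q) = smallPart x q ⌊T⌋₊ (a : ZMod q) +
      ∑ d ∈ (Finset.Ioc ⌊T⌋₊ ⌊x⌋₊).filter (Nat.Coprime · q),
        (ArithmeticFunction.moebius d : ℝ) * sqMultiplesCount x q d a -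
      x / q * (c q - ∑ d ∈ Finset.Icc 1 ⌊T⌋₊, cTerm q d) := by
    rw [E, S_eq_sum, hsplit, Finset.sum_union hdisj, hsmall]
    ring
  rw [heq]
  refine (abs_sub _ _).trans (add_le_add ((abs_add_le _ _).trans (add_le_add le_rfl ?_)) ?_)
  · calc _ ≤ ∑ d ∈ (Finset.Ioc ⌊T⌋₊ ⌊x⌋₊).filter (Nat.Coprime · q),
          (sqMultiplesCount x q d a : ℝ) := by
          refine (Finset.abs_sum_le_sum_abs _ _).trans (Finset.sum_le_sum fun d _ => ?_)
          rw [abs_mul, Nat.abs_cast]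
          refine mul_le_of_le_one_left (Nat.cast_nonneg _) ?_
          exact_mod_cast ArithmeticFunction.abs_moebius_le_one
      _ ≤ _ := Finset.sum_le_sum_of_subset_of_nonneg (Finset.filter_subset _ _)
          fun _ _ _ => Nat.cast_nonneg _
  · rw [abs_mul, abs_of_nonneg (show 0 ≤ x / q by positivity)]
    exact mul_le_mul_of_nonneg_left (abs_c_sub_sum_le q hT) (by positivity)

theorem sum_units_le_sum {q : ℕ} [NeZero q] (f : ZMod q → ℝ) (hf : ∀ a, 0 ≤ f a) :
    ∑ a : (ZMod q)ˣ, f a ≤ ∑ a : ZMod q, f a := by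
  have h := Finset.sum_map Finset.univ
    ⟨fun a : (ZMod q)ˣ => (a : ZMod q), Units.val_injective⟩ f
  refine h.symm.le.trans ?_
  exact Finset.sum_le_sum_of_subset_of_nonneg (Finset.subset_univ _) fun a _ _ => hf a

theorem sum_sqMultiplesCount_le {x : ℝ} (hx : 0 ≤ x) (q d : ℕ) [NeZero q] :
    ∑ a : (ZMod q)ˣ, (sqMultiplesCount x q d a : ℝ) ≤ x * ((d : ℝ) ^ 2)⁻¹ := by
  refine (sum_units_le_sum (fun a => (sqMultiplesCount x q d a : ℝ))
    fun _ => Nat.cast_nonneg _).trans ?_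
  have h : ∑ a : ZMod q, sqMultiplesCount x q d a = ⌊x / (d : ℝ) ^ 2⌋₊ := by
    have := Finset.card_eq_sum_card_fiberwise (s := Finset.Icc 1 ⌊x / (d : ℝ) ^ 2⌋₊)
      (f := fun m : ℕ => (m : ZMod q) * (d : ZMod q) ^ 2) (t := Finset.univ)
      (fun _ _ => Finset.mem_coe.mpr (Finset.mem_univ _))
    rw [Nat.card_Icc, Nat.add_sub_cancel] at this
    exact this.symm
  rw [← Nat.cast_sum, h, ← div_eq_mul_inv]
  exact Nat.floor_le (by positivity)

/-- Summing over the classes costs at most `x / d ^ 2` for each `d > T`, in total `2 x / T`; the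
tail of `c_q` costs at most `q · (x / q) · (2 / T)`, again `2 x / T`. -/
theorem sum_abs_E_le {x T : ℝ} (hT : 0 < T) (hTx : T ≤ x) (q : ℕ) [NeZero q] :
    ∑ a : (ZMod q)ˣ, |E x q (a : ZMod q)| ≤
      ∑ a : ZMod q, |smallPart x q ⌊T⌋₊ a| + 4 * (x / T) := by
  have hx : 0 ≤ x := hT.le.trans hTx
  have hq : (0 : ℝ) < q := by exact_mod_cast Nat.pos_of_ne_zero (NeZero.ne q)
  refine (Finset.sum_le_sum fun a _ => abs_E_le hT hTx a).trans ?_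
  rw [Finset.sum_add_distrib, Finset.sum_add_distrib, add_assoc]
  refine add_le_add (sum_units_le_sum _ fun _ => abs_nonneg _) ?_
  have h1 : ∑ a : (ZMod q)ˣ, ∑ d ∈ Finset.Ioc ⌊T⌋₊ ⌊x⌋₊, (sqMultiplesCount x q d a : ℝ) ≤
      2 * (x / T) := by
    rw [Finset.sum_comm]
    refine (Finset.sum_le_sum fun d _ => sum_sqMultiplesCount_le hx q d).trans ?_
    rw [← Finset.mul_sum]
    calc _ ≤ x * (2 / T) := by
          refine mul_le_mul_of_nonneg_left (sum_inv_sq_le _ hT fun d hd => ?_) hx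
          exact (Nat.floor_lt hT.le).mp (Finset.mem_Ioc.mp hd).1
      _ = _ := by ring
  have h2 : ∑ _a : (ZMod q)ˣ, x / q * (2 / T) ≤ 2 * (x / T) := by
    rw [Finset.sum_const, nsmul_eq_mul, Finset.card_univ]
    have h3 : (Fintype.card (ZMod q)ˣ : ℝ) ≤ q := by
      rw [ZMod.card_units_eq_totient]
      exact_mod_cast Nat.totient_le q
    calc _ ≤ (q : ℝ) * (x / q * (2 / T)) := by gcongr
      _ = _ := by field_simp
  linarith

/-! ### Exponents and the conclusion. -/

/-- In terms of fourth roots, the left side is the sum of the squares of the two terms on the right;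
the cross term is nonnegative. -/
theorem sqrt_mul_add_le {x y : ℝ} (hx : 0 < x) (hy : 0 < y) :
    √x * (y * √y) + x * √y ≤
      (x ^ (1 / 4 : ℝ) * y ^ (3 / 4 : ℝ) + x ^ (1 / 2 : ℝ) * y ^ (1 / 4 : ℝ)) ^ 2 := by
  have e : ∀ z : ℝ, 0 < z → ∃ w : ℝ, 0 < w ∧ z = w ^ 4 ∧ √z = w ^ 2 ∧ z ^ (1 / 4 : ℝ) = w ∧
      z ^ (1 / 2 : ℝ) = w ^ 2 ∧ z ^ (3 / 4 : ℝ) = w ^ 3 := by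
    intro z hz
    refine ⟨z ^ (1 / 4 : ℝ), by positivity, ?_, ?_, rfl, ?_, ?_⟩
    · rw [← Real.rpow_natCast, ← Real.rpow_mul hz.le]; norm_num
    · rw [Real.sqrt_eq_rpow, ← Real.rpow_natCast, ← Real.rpow_mul hz.le]; norm_num
    · rw [← Real.rpow_natCast, ← Real.rpow_mul hz.le]; norm_num
    · rw [← Real.rpow_natCast, ← Real.rpow_mul hz.le]; norm_num
  obtain ⟨u, hu, u1, u2, u3, u4, u5⟩ := e x hx
  obtain ⟨v, hv, v1, v2, v3, v4, v5⟩ := e y hy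
  rw [u2, u3, u4, v2, v3, v5, u1, v1]
  have : 0 ≤ u * v ^ 3 * (u ^ 2 * v) := by positivity
  nlinarith

theorem div_sqrt_div_sqrt {x y : ℝ} (hx : 0 < x) (hy : 0 < y) :
    x / √(x / √y) = x ^ (1 / 2 : ℝ) * y ^ (1 / 4 : ℝ) := by
  have h1 : √(√y) = y ^ (1 / 4 : ℝ) := by
    rw [Real.sqrt_eq_rpow, Real.sqrt_eq_rpow, ← Real.rpow_mul hy.le]; norm_num
  rw [Real.sqrt_div hx.le, h1, ← Real.sqrt_eq_rpow]
  have h2 : 0 < √x := Real.sqrt_pos.mpr hx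
  have h3 : 0 < y ^ (1 / 4 : ℝ) := by positivity
  nth_rewrite 1 [← Real.mul_self_sqrt hx.le]
  field_simp

end SquarefreeAP

theorem corollary5 (ε : ℝ) (hε : 0 < ε) :
    ∃ C : ℝ, 0 < C ∧ ∀ (x : ℝ) (q : ℕ) [NeZero q], 1 ≤ x → (q : ℝ) ≤ x →
      ∑ a : (ZMod q)ˣ, |SquarefreeAP.E x q (a : ZMod q)| ≤
        C * (x ^ ε * (x ^ (1 / 4 : ℝ) * (q : ℝ) ^ (3 / 4 : ℝ) +
          x ^ (1 / 2 : ℝ) * (q : ℝ) ^ (1 / 4 : ℝ))) := by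
  -- The bound for `A ^ 2` contains the number of levels squared and `τ(q)` once. Exponents `ε / 2`
  -- and `ε` give `x ^ (2 ε)` in all, with square root `x ^ ε`.
  obtain ⟨C₁, hC₁, hL⟩ := SquarefreeAP.exists_log_add_one_le (half_pos hε)
  obtain ⟨C₂, hC₂, hτ⟩ := SquarefreeAP.exists_card_divisors_le hε
  have hK1 : 1 ≤ C₁ ^ 2 * C₂ := one_le_mul_of_one_le_of_one_le (one_le_pow₀ hC₁) hC₂
  refine ⟨129 * (C₁ ^ 2 * C₂) + 4, by positivity, fun x q _ hx hqx => ?_⟩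
  have hx0 : 0 < x := by linarith
  have hqN : q ≠ 0 := NeZero.ne q
  have hq1 : (1 : ℝ) ≤ q := by exact_mod_cast Nat.pos_of_ne_zero hqN
  have hq0 : (0 : ℝ) < q := by linarith
  have hsq0 : 0 < √(q : ℝ) := Real.sqrt_pos.mpr hq0
  have hsqx : √(q : ℝ) ≤ x := (Real.sqrt_le_left (by linarith) |>.mpr (by nlinarith)).trans hqx
  -- This choice balances `q T ^ 2`, from the quadratic term of the triple count, with the squared
  -- tail `(x / T) ^ 2`; both equal `x √q`.
  set T : ℝ := √(x / √q) with hT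
  have hT1 : 1 ≤ T := Real.one_le_sqrt.mpr ((one_le_div hsq0).mpr hsqx)
  have hT2 : T ^ 2 * √q = x := by
    rw [hT, Real.sq_sqrt (by positivity)]; field_simp
  have hTx : T ≤ x := by
    have h1 : T ≤ T ^ 2 := le_self_pow₀ hT1 two_ne_zero
    have h2 : T ^ 2 ≤ T ^ 2 * √q :=
      le_mul_of_one_le_right (by positivity) (Real.one_le_sqrt.mpr hq1)
    linarith
  have hn : ((⌊T⌋₊ : ℕ) : ℝ) ^ 2 * √q ≤ x := by
    rw [← hT2]
    have := Nat.floor_le (show 0 ≤ T by linarith)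
    gcongr
  have hmain := SquarefreeAP.sum_abs_E_le (by linarith) hTx q
  have hsm := SquarefreeAP.sq_sum_abs_smallPart_le (Nat.floor_pos.mpr hT1) hx hn
  have hdiv : x / T = x ^ (1 / 2 : ℝ) * (q : ℝ) ^ (1 / 4 : ℝ) :=
    SquarefreeAP.div_sqrt_div_sqrt hx0 hq0
  have hY := SquarefreeAP.sqrt_mul_add_le hx0 hq0
  rw [hdiv] at hmain
  set A := ∑ a : ZMod q, |SquarefreeAP.smallPart x q ⌊T⌋₊ a|
  set Z₁ := x ^ (1 / 4 : ℝ) * (q : ℝ) ^ (3 / 4 : ℝ)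
  set Z₂ := x ^ (1 / 2 : ℝ) * (q : ℝ) ^ (1 / 4 : ℝ)
  have hZ₁ : 0 ≤ Z₁ := by positivity
  have hZ₂ : 0 ≤ Z₂ := by positivity
  have hxε : 1 ≤ x ^ ε := Real.one_le_rpow hx hε.le
  have hA : A ≤ 129 * (C₁ ^ 2 * C₂) * (x ^ ε * (Z₁ + Z₂)) := by
    refine le_of_sq_le_sq ?_ (by positivity)
    have hτ' : (q.divisors.card : ℝ) ≤ C₂ * x ^ ε :=
      (hτ q hqN).trans (by gcongr)
    have hhalf : (x ^ (ε / 2)) ^ 2 = x ^ ε := by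
      rw [← Real.rpow_natCast, ← Real.rpow_mul hx0.le]; congr 1; push_cast; ring
    calc A ^ 2 ≤ _ := hsm
      _ ≤ 129 * (C₁ * x ^ (ε / 2)) ^ 2 * (C₂ * x ^ ε) * (Z₁ + Z₂) ^ 2 := by
          have := hL x hx
          gcongr
      _ = 129 * (C₁ ^ 2 * C₂) * (x ^ ε * (Z₁ + Z₂)) ^ 2 := by
          rw [mul_pow, hhalf]; ring
      -- The constant is at least `1`, so squaring it makes the right side a perfect square.
      _ ≤ (129 * (C₁ ^ 2 * C₂)) ^ 2 * (x ^ ε * (Z₁ + Z₂)) ^ 2 := by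
          have : 129 * (C₁ ^ 2 * C₂) ≤ (129 * (C₁ ^ 2 * C₂)) ^ 2 :=
            le_self_pow₀ (by linarith) two_ne_zero
          gcongr
      _ = _ := by ring
  have hB : 4 * Z₂ ≤ 4 * (x ^ ε * (Z₁ + Z₂)) := by
    have : Z₂ ≤ x ^ ε * (Z₁ + Z₂) := by nlinarith
    linarith
  calc _ ≤ _ := hmain
    _ ≤ 129 * (C₁ ^ 2 * C₂) * (x ^ ε * (Z₁ + Z₂)) + 4 * (x ^ ε * (Z₁ + Z₂)) := add_le_add hA hB
    _ = _ := by ring
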